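/- **Setting.** Let $d\ge 1$, $\alpha\in(0,\infty)^d$, $\beta\in\mathbb R^d$. For $n\in\mathbb N_0^d$ let $$\mathcal H_n^{\alpha,\beta}(x)=\prod_{j=1}^d\Big(\frac{\alpha_j}{2^{n_j}n_j!\sqrt\pi}\Big)^{1/2}H_{n_j}(\alpha_j(x_j-\beta_j))\,e^{-\frac12\alpha_j^2(x_j-\beta_j)^2},\qquad H_k(y)=(-1)^ke^{y^2}\partial_y^ke^{-y^2}.$$ Let $\mathcal D_{x_j}=\partial_{x_j}+\alpha_j^2(x_j-\beta_j)$ and $\mathcal D^k=\mathcal D_{x_1}^{k_1}\cdots\mathcal D_{x_d}^{k_d}$ (in the sense of distributions). For $m\in\mathbb N_0$ the weighted Korobov space is $$\mathcal K^m_{\alpha,\beta}(\mathbb R^d)=\{u:\ \mathcal D^ku\in L^2(\mathbb R^d),\ 0\le|k|_\infty\le m\},\qquad \|u\|^2_{\mathcal K^m_{\alpha,\beta}}=\sum_{0\le|k|_\infty\le m}\|\mathcal D^ku\|^2,$$ where $\|\cdot\|$ is the norm and $\langle\cdot,\cdot\rangle$ the scalar product of $L^2(\mathbb R^d)$. For $N\ge1$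 and $\gamma<1$ let $$\Omega_{N,\gamma}=\{0\}\cup\{n\in\mathbb N_0^d\setminus\{0\}:\ |n|_{\rm mix}\,|n|_\infty^{-\gamma}\le N^{1-\gamma}\},\qquad |n|_{\rm mix}=\prod_{j=1}^d\max\{1,n_j\},\qquad X_{N,\gamma}=\operatorname{span}\{\mathcal H_n^{\alpha,\beta}:n\in\Omega_{N,\gamma}\};$$ $\gamma=0$ gives the regular hyperbolic cross $|n|_{\rm mix}\le N$, and $0<\gamma<1$ the optimized hyperbolic cross. Consider $\partial_tu+Lu=f$ on $\mathbb R^d\times(0,T)$, $u(\cdot,0)=u_0$, with $T>0$, $u_0\in L^2(\mathbb R^d)$, $f\in L^1(0,T;L^2(\mathbb R^d))$ and $Lu=-\nabla\cdot(A\nabla u)+b\cdot\nabla u+cu$, where $A=(a_{ij})$, $b=(b_i)$ and $c$ are real functions on $\mathbb R^d$, with bilinear form $$\mathcal A(u,v)=\int_{\mathbb R^d}(A\nabla u)\cdot\nabla v+v\,b\cdot\nabla u+c\,u\,v\;dx .$$ Assume: (C1) for all $u,v\in H^1(\mathbb R^d)$ the integrand of $\mathcal A(u,v)$ is integrable and $|\mathcal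 A(u,v)|\le C\|u\|_{H^1}\|v\|_{H^1}$, with a constant $C>0$; (C2) $\mathcal A(u,u)\ge\kappa\|u\|_{H^1}^2$ for all $u\in H^1(\mathbb R^d)$, with a constant $\kappa>0$; (C3) $a_{ij},b_i,c\in C^\infty(\mathbb R^d)$. A solution is a function $u\in C([0,T];L^2)\cap L^2(0,T;H^1)$ with $u(0)=u_0$ such that, for every $\varphi\in H^1(\mathbb R^d)$, $\langle u(t),\varphi\rangle$ is absolutely continuous on $[0,T]$ and $\frac{d}{dt}\langle u,\varphi\rangle+\mathcal A(u,\varphi)=\langle f,\varphi\rangle$ for a.e. $t\in(0,T)$. The Galerkin Hermite spectral solution $u_N$ is an absolutely continuous function $u_N:[0,T]\to X_{N,\gamma}$ with $$\langle\partial_tu_N,\varphi\rangle+\mathcal A(u_N,\varphi)=\langle f,\varphi\rangle\ \text{ for a.e. }t\in(0,T),\qquad \langle u_N(0),\varphi\rangle=\langle u_0,\varphi\rangle,\qquad\forall\varphi\in X_{N,\gamma}.$$ **Theorem.** Let $m>1$ be an integer and let $\gamma\le\frac1m$ be real. There is a constant $K>0$ depending only on $d,m,\gamma,\alpha,C,\kappa$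 such that the following holds for all $\beta$, $T$, $f$, $u_0$ and all coefficients satisfying (C1)–(C3) with the constants $C,\kappa$: if the solution satisfies $u\in L^\infty(0,T;\mathcal K^m_{\alpha,\beta}(\mathbb R^d))\cap L^2(0,T;\mathcal K^m_{\alpha,\beta}(\mathbb R^d))$, then for every integer $N\ge1$ and every $t\in[0,T]$ $$\|u-u_N\|(t)\le c^*N^{\frac{1-m}2},\qquad c^*=K\big(\|u\|_{L^\infty(0,T;\mathcal K^m_{\alpha,\beta})}+\|u\|_{L^2(0,T;\mathcal K^m_{\alpha,\beta})}\big).$$ -/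

import Mathlib

open MeasureTheory Set
open scoped SchwartzMap ContDiff

noncomputable section

namespace HermiteSpectral

/-! ### The space `L²(ℝᵈ)`

Points of `ℝᵈ` are functions `Fin d → ℝ`; only the coordinates and the Lebesgue measure of `ℝᵈ`
are used (never a norm of a point), so this is the usual `L²(ℝᵈ)`. -/

/-- The real Hilbert space `L²(ℝᵈ)` with respect to Lebesgue measure. -/
abbrev L2 (d : ℕ) : Type := Lp ℝ 2 (volume : Measure (Fin d → ℝ))

/-- A product of an `L²` function and a Schwartz function is integrable. -/
theorem integrable_mul_schwartz {d : ℕ} (u : L2 d) (φ : 𝓢(Fin d → ℝ, ℝ)) :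
    Integrable (fun x => u x * φ x) :=
  (Lp.memLp u).integrable_mul (φ.memLp 2)

/-! ### Generalized Hermite functions -/

/-- The physicists' Hermite polynomial `H_n(x) = (-1)ⁿ e^{x²} ∂ₓⁿ e^{-x²}`. -/
def hermiteH (n : ℕ) (x : ℝ) : ℝ :=
  (-1) ^ n * Real.exp (x ^ 2) * iteratedDeriv n (fun y : ℝ => Real.exp (-y ^ 2)) x

/-- The one-dimensional generalized Hermite function with scaling factor `a` and translating
factor `b`. -/
def hermiteFun (a b : ℝ) (n : ℕ) (x : ℝ) : ℝ :=
  Real.sqrt (a / (2 ^ n * (n.factorial : ℝ) * Real.sqrt Real.pi)) * hermiteH n (a * (x - b)) *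
    Real.exp (-(1 / 2) * a ^ 2 * (x - b) ^ 2)

/-- The tensorial generalized Hermite functions on `ℝᵈ`. -/
def hermiteTensor {d : ℕ} (α β : Fin d → ℝ) (n : Fin d → ℕ) (x : Fin d → ℝ) : ℝ :=
  ∏ j, hermiteFun (α j) (β j) (n j) (x j)

/-! ### Hyperbolic cross approximation spaces -/

/-- `|n|_mix = ∏ⱼ max(1, nⱼ)`. -/
def mixNorm {d : ℕ} (n : Fin d → ℕ) : ℕ := ∏ j, max 1 (n j)

/-- `|n|_∞ = maxⱼ nⱼ`. -/
def supNorm {d : ℕ} (n : Fin d → ℕ) : ℕ := Finset.univ.sup n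

/-- The hyperbolic cross `{n : |n|_mix |n|_∞^{-γ} ≤ N^{1-γ}}`. For `γ = 0` it is the regular
hyperbolic cross `{n : |n|_mix ≤ N}`, for `0 < γ < 1` the optimized one. The index `n = 0`, where
`|n|_∞^{-γ}` is `0^{-γ}`, always belongs to it. -/
def hyperbolicCross (d N : ℕ) (γ : ℝ) : Set (Fin d → ℕ) :=
  {n | n = 0 ∨ (mixNorm n : ℝ) * (supNorm n : ℝ) ^ (-γ) ≤ (N : ℝ) ^ (1 - γ)}

/-- The approximation space `X = span {𝓗_n : n ∈ Ω}`, as a subspace of `L²(ℝᵈ)`. -/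
def approxSpace {d : ℕ} (α β : Fin d → ℝ) (Ω : Set (Fin d → ℕ)) : Submodule ℝ (L2 d) :=
  Submodule.span ℝ {h : L2 d | ∃ n ∈ Ω, h =ᵐ[volume] hermiteTensor α β n}

/-! ### The Sobolev space `H¹(ℝᵈ)` -/

/-- `g = ∂_{x_j} u` in the sense of distributions, for `u, g ∈ L²(ℝᵈ)` (tested with all real
Schwartz functions, equivalently with all smooth compactly supported functions). -/
def IsWeakPartial {d : ℕ} (j : Fin d) (u g : L2 d) : Prop :=
  ∀ φ : 𝓢(Fin d → ℝ, ℝ),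
    ∫ x, g x * φ x = -∫ x, u x * fderiv ℝ φ x (Pi.single j 1)

theorem integrable_mul_fderiv {d : ℕ} (j : Fin d) (u : L2 d) (φ : 𝓢(Fin d → ℝ, ℝ)) :
    Integrable (fun x => u x * fderiv ℝ φ x (Pi.single j 1)) :=
  integrable_mul_schwartz u (LineDeriv.lineDerivOp (Pi.single j (1 : ℝ) : Fin d → ℝ) φ)

/-- The Sobolev space `H¹(ℝᵈ)`, whose elements are `L²` functions together with their weak
gradient. The norm inherited from the ambient Hilbert sum is
`‖u‖²_{H¹} = ‖u‖² + ∑ⱼ ‖∂ⱼ u‖²`. -/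
def sobolevH1 (d : ℕ) : Submodule ℝ (WithLp 2 (L2 d × PiLp 2 (fun _ : Fin d => L2 d))) where
  carrier := {p | ∀ j, IsWeakPartial j p.fst (p.snd j)}
  zero_mem' := by
    intro j φ
    have h := Lp.coeFn_zero ℝ 2 (volume : Measure (Fin d → ℝ))
    have h1 : ∫ x, (0 : L2 d) x * φ x = 0 :=
      integral_eq_zero_of_ae (by filter_upwards [h] with x hx; rw [hx]; simp)
    have h2 : ∫ x, (0 : L2 d) x * fderiv ℝ φ x (Pi.single j 1) = 0 :=
      integral_eq_zero_of_ae (by filter_upwards [h] with x hx; rw [hx]; simp)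
    change ∫ x, (0 : L2 d) x * φ x = -∫ x, (0 : L2 d) x * fderiv ℝ φ x (Pi.single j 1)
    rw [h1, h2, neg_zero]
  add_mem' := by
    intro p q hp hq j φ
    have e1 : ∫ x, (p.snd j + q.snd j) x * φ x
        = (∫ x, p.snd j x * φ x) + ∫ x, q.snd j x * φ x := by
      rw [← integral_add (integrable_mul_schwartz _ _) (integrable_mul_schwartz _ _)]
      refine integral_congr_ae ?_
      filter_upwards [Lp.coeFn_add (p.snd j) (q.snd j)] with x hx
      rw [hx, Pi.add_apply, add_mul]
    have e2 : ∫ x, (p.fst + q.fst) x * fderiv ℝ φ x (Pi.single j 1)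
        = (∫ x, p.fst x * fderiv ℝ φ x (Pi.single j 1))
          + ∫ x, q.fst x * fderiv ℝ φ x (Pi.single j 1) := by
      rw [← integral_add (integrable_mul_fderiv _ _ _) (integrable_mul_fderiv _ _ _)]
      refine integral_congr_ae ?_
      filter_upwards [Lp.coeFn_add p.fst q.fst] with x hx
      rw [hx, Pi.add_apply, add_mul]
    change ∫ x, (p.snd j + q.snd j) x * φ x
      = -∫ x, (p.fst + q.fst) x * fderiv ℝ φ x (Pi.single j 1)
    rw [e1, e2, hp j φ, hq j φ, neg_add]
  smul_mem' := by
    intro c p hp j φ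
    have e1 : ∫ x, (c • p.snd j) x * φ x = c * ∫ x, p.snd j x * φ x := by
      rw [← integral_const_mul]
      refine integral_congr_ae ?_
      filter_upwards [Lp.coeFn_smul c (p.snd j)] with x hx
      rw [hx, Pi.smul_apply, smul_eq_mul, mul_assoc]
    have e2 : ∫ x, (c • p.fst) x * fderiv ℝ φ x (Pi.single j 1)
        = c * ∫ x, p.fst x * fderiv ℝ φ x (Pi.single j 1) := by
      rw [← integral_const_mul]
      refine integral_congr_ae ?_
      filter_upwards [Lp.coeFn_smul c p.fst] with x hx
      rw [hx, Pi.smul_apply, smul_eq_mul, mul_assoc]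
    change ∫ x, (c • p.snd j) x * φ x = -∫ x, (c • p.fst) x * fderiv ℝ φ x (Pi.single j 1)
    rw [e1, e2, hp j φ, mul_neg]

/-- The space `H¹(ℝᵈ)` as a type. -/
abbrev H1 (d : ℕ) : Type := ↥(sobolevH1 d)

/-- The function underlying an element of `H¹(ℝᵈ)`. -/
def H1.toL2 {d : ℕ} (U : H1 d) : L2 d := (U : WithLp 2 (L2 d × PiLp 2 fun _ : Fin d => L2 d)).fst

/-- The weak partial derivative `∂_{x_j} U` of an element of `H¹(ℝᵈ)`. -/
def H1.partial {d : ℕ} (U : H1 d) (j : Fin d) : L2 d :=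
  (U : WithLp 2 (L2 d × PiLp 2 fun _ : Fin d => L2 d)).snd j

/-! ### The weighted Korobov spaces -/

/-- `w = 𝒟_{x_j} u` in the sense of distributions, where `𝒟_{x_j} = ∂_{x_j} + α_j² (x_j - β_j)`:
the formal adjoint of `𝒟_{x_j}` is `-∂_{x_j} + α_j² (x_j - β_j)`. -/
def IsHermiteDeriv {d : ℕ} (α β : Fin d → ℝ) (j : Fin d) (u w : L2 d) : Prop :=
  ∀ φ : 𝓢(Fin d → ℝ, ℝ),
    ∫ x, w x * φ x =
      ∫ x, u x * (-(fderiv ℝ φ x (Pi.single j 1)) + α j ^ 2 * (x j - β j) * φ x)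

theorem integrable_mul_adjoint {d : ℕ} (α β : Fin d → ℝ) (j : Fin d) (u : L2 d)
    (φ : 𝓢(Fin d → ℝ, ℝ)) :
    Integrable
      (fun x => u x * (-(fderiv ℝ φ x (Pi.single j 1)) + α j ^ 2 * (x j - β j) * φ x)) := by
  have hg : (fun x : Fin d → ℝ => α j ^ 2 * (x j - β j)).HasTemperateGrowth := by
    have h1 : (fun x : Fin d → ℝ => x j).HasTemperateGrowth :=
      (ContinuousLinearMap.proj (R := ℝ) (φ := fun _ : Fin d => ℝ) j).hasTemperateGrowth
    exact (Function.HasTemperateGrowth.const _).mul (h1.sub (Function.HasTemperateGrowth.const _))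
  have h2 := integrable_mul_schwartz u
    (SchwartzMap.smulLeftCLM ℝ (fun x : Fin d → ℝ => α j ^ 2 * (x j - β j)) φ)
  refine ((integrable_mul_fderiv j u φ).neg.add h2).congr (Filter.Eventually.of_forall fun x => ?_)
  simp only [Pi.add_apply, Pi.neg_apply, SchwartzMap.smulLeftCLM_apply_apply hg, smul_eq_mul]
  ring

/-- The weighted Korobov space `𝓚^m_{α,β}(ℝᵈ) = {u : 𝒟^k u ∈ L²(ℝᵈ), 0 ≤ |k|_∞ ≤ m}`. An element
is the family `(𝒟^k u)` indexed by all multi-indices `k` with entries in `{0, …, m}`; membership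
says that `𝒟^{k + e_j} u = 𝒟_{x_j} (𝒟^k u)` whenever `k` and `k + e_j` are such multi-indices, so
the family is determined by its member `u` with index `k = 0`. The norm inherited from the ambient
Hilbert sum is `‖u‖²_{𝓚^m} = ∑_{|k|_∞ ≤ m} ‖𝒟^k u‖²`. -/
def korobovSpace {d : ℕ} (α β : Fin d → ℝ) (m : ℕ) :
    Submodule ℝ (PiLp 2 (fun _ : Fin d → Fin (m + 1) => L2 d)) where
  carrier := {w | ∀ (k k' : Fin d → Fin (m + 1)) (j : Fin d),
    (k' j : ℕ) = (k j : ℕ) + 1 → (∀ i, i ≠ j → k' i = k i) → IsHermiteDeriv α β j (w k) (w k')}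
  zero_mem' := by
    intro k k' j _ _ φ
    have h := Lp.coeFn_zero ℝ 2 (volume : Measure (Fin d → ℝ))
    have h1 : ∫ x, (0 : L2 d) x * φ x = 0 :=
      integral_eq_zero_of_ae (by filter_upwards [h] with x hx; rw [hx]; simp)
    have h2 : ∫ x, (0 : L2 d) x *
        (-(fderiv ℝ φ x (Pi.single j 1)) + α j ^ 2 * (x j - β j) * φ x) = 0 :=
      integral_eq_zero_of_ae (by filter_upwards [h] with x hx; rw [hx]; simp)
    exact h1.trans h2.symm
  add_mem' := by
    intro p q hp hq k k' j h1 h2 φ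
    have e1 : ∫ x, (p k' + q k') x * φ x = (∫ x, p k' x * φ x) + ∫ x, q k' x * φ x := by
      rw [← integral_add (integrable_mul_schwartz _ _) (integrable_mul_schwartz _ _)]
      refine integral_congr_ae ?_
      filter_upwards [Lp.coeFn_add (p k') (q k')] with x hx
      rw [hx, Pi.add_apply, add_mul]
    have e2 := integral_add (integrable_mul_adjoint α β j (p k) φ)
      (integrable_mul_adjoint α β j (q k) φ)
    refine e1.trans ?_
    rw [hp k k' j h1 h2 φ, hq k k' j h1 h2 φ, ← e2]
    refine integral_congr_ae ?_
    filter_upwards [Lp.coeFn_add (p k) (q k)] with x hx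
    rw [PiLp.add_apply, hx, Pi.add_apply, add_mul]
  smul_mem' := by
    intro c p hp k k' j h1 h2 φ
    have e1 : ∫ x, (c • p k') x * φ x = c * ∫ x, p k' x * φ x := by
      rw [← integral_const_mul]
      refine integral_congr_ae ?_
      filter_upwards [Lp.coeFn_smul c (p k')] with x hx
      rw [hx, Pi.smul_apply, smul_eq_mul, mul_assoc]
    refine e1.trans ?_
    rw [hp k k' j h1 h2 φ, ← integral_const_mul]
    refine integral_congr_ae ?_
    filter_upwards [Lp.coeFn_smul c (p k)] with x hx
    simp only [PiLp.smul_apply, hx, Pi.smul_apply, smul_eq_mul]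
    ring

/-- The weighted Korobov space `𝓚^m_{α,β}(ℝᵈ)` as a type. -/
abbrev Korobov {d : ℕ} (α β : Fin d → ℝ) (m : ℕ) : Type := ↥(korobovSpace α β m)

/-- The function `u = 𝒟^0 u` underlying an element of `𝓚^m_{α,β}(ℝᵈ)`. -/
def Korobov.toL2 {d : ℕ} {α β : Fin d → ℝ} {m : ℕ} (w : Korobov α β m) : L2 d :=
  (w : PiLp 2 (fun _ : Fin d → Fin (m + 1) => L2 d)) 0

/-! ### The bilinear form and its properties -/

/-- The coefficients `A = (a_ij)`, `b = (b_i)` and `c` of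
`L u = -∇·(A ∇u) + b·∇u + c u`. -/
structure Coefficients (d : ℕ) where
  A : (Fin d → ℝ) → Matrix (Fin d) (Fin d) ℝ
  b : (Fin d → ℝ) → Fin d → ℝ
  c : (Fin d → ℝ) → ℝ

/-- The integrand `(A ∇U)·∇V + V b·∇U + c U V` of the bilinear form of `L`. -/
def Coefficients.integrand {d : ℕ} (P : Coefficients d) (U V : H1 d) (x : Fin d → ℝ) : ℝ :=
  (∑ i, ∑ j, P.A x i j * U.partial j x * V.partial i x)
    + V.toL2 x * (∑ i, P.b x i * U.partial i x) + P.c x * U.toL2 x * V.toL2 x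

/-- The bilinear form `𝒜(U, V) = ∫ (A ∇U)·∇V + V b·∇U + c U V dx`. -/
def Coefficients.form {d : ℕ} (P : Coefficients d) (U V : H1 d) : ℝ :=
  ∫ x, P.integrand U V x

/-- The form is defined and continuous on `H¹(ℝᵈ)`, with constant `C`. -/
def Coefficients.IsContinuous {d : ℕ} (P : Coefficients d) (C : ℝ) : Prop :=
  ∀ U V : H1 d, Integrable (P.integrand U V) ∧ |P.form U V| ≤ C * ‖U‖ * ‖V‖

/-- The form is coercive on `H¹(ℝᵈ)`, with constant `κ`. -/
def Coefficients.IsCoercive {d : ℕ} (P : Coefficients d) (κ : ℝ) : Prop :=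
  ∀ U : H1 d, κ * ‖U‖ ^ 2 ≤ P.form U U

/-- The coefficients are smooth. -/
def Coefficients.IsSmooth {d : ℕ} (P : Coefficients d) : Prop :=
  (∀ i j, ContDiff ℝ ∞ fun x => P.A x i j) ∧ (∀ i, ContDiff ℝ ∞ fun x => P.b x i) ∧
    ContDiff ℝ ∞ P.c

/-! ### The parabolic problem and its Galerkin approximation -/

/-- `u` is a (weak) solution of `∂ₜ u + L u = f` on `ℝᵈ × (0,T)`, `u(0) = u₀`:
`u ∈ C([0,T]; L²) ∩ L²(0,T; H¹)` and, for every `φ ∈ H¹(ℝᵈ)`, the function `⟨u(t), φ⟩` is absolutely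
continuous with derivative `⟨f(t), φ⟩ - 𝒜(u(t), φ)` for almost every `t` and initial value
`⟨u₀, φ⟩`, written in integrated form. -/
def IsWeakSolution {d : ℕ} (P : Coefficients d) (T : ℝ) (f : ℝ → L2 d) (u₀ : L2 d)
    (u : ℝ → L2 d) : Prop :=
  ContinuousOn u (Icc 0 T) ∧ u 0 = u₀ ∧
  ∃ V : ℝ → H1 d, MemLp V 2 (volume.restrict (Ioc 0 T)) ∧
    (∀ᵐ s ∂(volume.restrict (Ioc 0 T)), (V s).toL2 = u s) ∧
    ∀ φ : H1 d, ∀ t ∈ Icc 0 T,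
      inner ℝ (u t) φ.toL2 + (∫ s in (0 : ℝ)..t, P.form (V s) φ)
        = inner ℝ u₀ φ.toL2 + ∫ s in (0 : ℝ)..t, inner ℝ (f s) φ.toL2

/-- `uN` is the Galerkin approximation in the subspace `X` of `L²(ℝᵈ)`: it is a continuous curve in
`X ∩ H¹(ℝᵈ)` and, for every `φ ∈ X ∩ H¹(ℝᵈ)`, the function `⟨uN(t), φ⟩` is absolutely continuous with
derivative `⟨f(t), φ⟩ - 𝒜(uN(t), φ)` for almost every `t` and initial value `⟨u₀, φ⟩` (that is,
`uN(0)` is the orthogonal projection of `u₀` to `X`), written in integrated form. -/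
def IsGalerkinSolution {d : ℕ} (P : Coefficients d) (T : ℝ) (f : ℝ → L2 d) (u₀ : L2 d)
    (X : Submodule ℝ (L2 d)) (uN : ℝ → H1 d) : Prop :=
  ContinuousOn uN (Icc 0 T) ∧ (∀ t ∈ Icc 0 T, (uN t).toL2 ∈ X) ∧
  ∀ φ : H1 d, φ.toL2 ∈ X → ∀ t ∈ Icc 0 T,
    inner ℝ (uN t).toL2 φ.toL2 + (∫ s in (0 : ℝ)..t, P.form (uN s) φ)
      = inner ℝ u₀ φ.toL2 + ∫ s in (0 : ℝ)..t, inner ℝ (f s) φ.toL2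

end HermiteSpectral

end

noncomputable section

namespace HermiteSpectral

/-! ### Schwartz functions of Gaussian type -/

/-! Let `P` be the `L²`-orthogonal projection onto the Hermite functions indexed by the hyperbolic
cross, and split `u - u_N = (u - P u) + (P u - u_N)`. Set `R = u - P u` and `E = u_N - P u = P (u_N
- u)`.

Approximation. In the Hermite basis `𝒟_{x_j}` acts as a weighted shift, so the Korobov norm controls
`∑ |n|_mix^m a_n²` for the coefficients `a_n` of `u` (`exists_tsum_mixNorm_pow_le`). The `H¹` norm
is in turn at most `∑ (1 + ∑ⱼ α_j² (2 n_j + 1)) a_n²`, a weight of order `|n|_∞` when `n ≠ 0`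
(`ofReal_norm_sq_H1_le`). Outside the cross, `|n|_∞ ≤ N^{1-m} |n|_mix^m`, and this is where `γ ≤
1/m` enters (`supNorm_le_of_notMem_hyperbolicCross`). Hence `‖R‖²_{H¹} ≲ N^{1-m} ‖u‖²_{𝓚^m}`
(`exists_norm_sub_hermiteProj_sq_le`).

Energy. Subtracting the two weak formulations removes `f` and `u₀`. Since `P` is `L²`-orthogonal,
`∂ₜ R` never appears: `d/dt ‖E‖² = 2 𝒜(R - E, E)` and `E(0) = 0`. Continuity, coercivity and Young's
inequality give `𝒜(R - E, E) ≤ C²/(4κ) ‖R‖²_{H¹}`, so integration in time suffices without Gronwall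
(`norm_sq_galerkin_sub_hermiteProj_le`). Thus `E` costs the `L²`-in-time Korobov norm, and `u - P u`
at a fixed time costs the `L^∞` one.

The expansions rest on the Hermite functions being a Hilbert basis of `L²(ℝᵈ)`. Orthonormality comes
from the ladder relations, completeness from uniqueness of characteristic functions. -/

theorem one_add_pow_mul_exp_neg_sq_le {c : ℝ} (hc : 0 < c) (K : ℕ) {r : ℝ} (hr : 0 ≤ r) :
    (1 + r) ^ K * Real.exp (-(c * r ^ 2)) ≤ K.factorial * Real.exp (1 + 1 / (4 * c)) := by
  have h1 : (1 + r) ^ K ≤ K.factorial * Real.exp (1 + r) := by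
    have := Real.pow_div_factorial_le_exp (1 + r) (by positivity) K
    rw [div_le_iff₀ (by positivity)] at this
    linarith
  have h2 : r - c * r ^ 2 ≤ 1 / (4 * c) := by
    rw [le_div_iff₀ (by positivity)]
    nlinarith [sq_nonneg (2 * c * r - 1)]
  calc (1 + r) ^ K * Real.exp (-(c * r ^ 2))
      ≤ K.factorial * Real.exp (1 + r) * Real.exp (-(c * r ^ 2)) := by gcongr
    _ = K.factorial * Real.exp (1 + (r - c * r ^ 2)) := by
        rw [mul_assoc, ← Real.exp_add]; ring_nf
    _ ≤ _ := by gcongr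

theorem norm_iteratedFDeriv_exp (n : ℕ) (y : ℝ) :
    ‖iteratedFDeriv ℝ n Real.exp y‖ = Real.exp y := by
  rw [norm_iteratedFDeriv_eq_norm_iteratedDeriv, iteratedDeriv_eq_iterate, Real.iter_deriv_exp,
    Real.norm_eq_abs, Real.abs_exp]

/-- If `Q` is of temperate growth and grows at least quadratically, `exp (-Q)` is a Schwartz
function. -/
theorem exists_schwartz_exp_neg {E : Type*} [NormedAddCommGroup E] [NormedSpace ℝ E] {Q : E → ℝ}
    (hQ : Q.HasTemperateGrowth) {c C : ℝ} (hc : 0 < c) (h : ∀ x, c * ‖x‖ ^ 2 - C ≤ Q x) :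
    ∃ φ : 𝓢(E, ℝ), ∀ x, φ x = Real.exp (-Q x) := by
  have hQn : (fun x => -Q x).HasTemperateGrowth := hQ.neg
  refine ⟨⟨fun x => Real.exp (-Q x), Real.contDiff_exp.comp hQn.1, ?_⟩, fun x => rfl⟩
  intro k n
  obtain ⟨l, B, hB, hbound⟩ := hQn.norm_iteratedFDeriv_le_uniform n
  refine ⟨n.factorial * (1 + B) ^ n * Real.exp C *
    ((k + l * n).factorial * Real.exp (1 + 1 / (4 * c))), fun x => ?_⟩
  set r := ‖x‖ with hr
  have hr0 : 0 ≤ r := norm_nonneg x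
  -- The Faà di Bruno bound asks for `D ^ i` at order `i`. As `D ≥ 1`, the single polynomial bound
  -- `D` suffices at every order `i ≥ 1`.
  have hD1 : 1 ≤ (1 + B) * (1 + r) ^ l := one_le_mul_of_one_le_of_one_le (by linarith)
    (one_le_pow₀ (by linarith))
  have h1 : ‖iteratedFDeriv ℝ n (Real.exp ∘ fun x => -Q x) x‖
      ≤ n.factorial * Real.exp (-Q x) * ((1 + B) * (1 + r) ^ l) ^ n := by
    refine norm_iteratedFDeriv_comp_le (N := ∞) Real.contDiff_exp hQn.1 (by exact_mod_cast le_top)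
      x ?_ ?_
    · intro i _
      exact (norm_iteratedFDeriv_exp i _).le
    · intro i hi hin
      refine (hbound i hin x).trans (le_trans ?_ (le_self_pow₀ hD1 (by omega)))
      gcongr
      linarith
  have h2 : Real.exp (-Q x) ≤ Real.exp C * Real.exp (-(c * r ^ 2)) := by
    rw [← Real.exp_add]
    exact Real.exp_le_exp.2 (by linarith [h x])
  have h3 : r ^ k ≤ (1 + r) ^ k := by gcongr; linarith
  calc r ^ k * ‖iteratedFDeriv ℝ n (Real.exp ∘ fun x => -Q x) x‖
      ≤ (1 + r) ^ k * (n.factorial * (Real.exp C * Real.exp (-(c * r ^ 2))) *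
          ((1 + B) * (1 + r) ^ l) ^ n) := by
        refine mul_le_mul h3 (h1.trans ?_) (norm_nonneg _) (by positivity)
        gcongr
    _ = n.factorial * (1 + B) ^ n * Real.exp C *
          ((1 + r) ^ (k + l * n) * Real.exp (-(c * r ^ 2))) := by
        rw [mul_pow, ← pow_mul, pow_add]; ring
    _ ≤ _ := by
        exact mul_le_mul_of_nonneg_left (one_add_pow_mul_exp_neg_sq_le hc _ hr0) (by positivity)

theorem hasTemperateGrowth_coord {d : ℕ} (j : Fin d) :
    (fun x : Fin d → ℝ => x j).HasTemperateGrowth :=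
  (ContinuousLinearMap.proj (R := ℝ) (φ := fun _ : Fin d => ℝ) j).hasTemperateGrowth

theorem hasTemperateGrowth_finset_prod {E ι : Type*} [NormedAddCommGroup E] [NormedSpace ℝ E]
    {f : ι → E → ℝ} (s : Finset ι) (hf : ∀ i ∈ s, (f i).HasTemperateGrowth) :
    (fun x => ∏ i ∈ s, f i x).HasTemperateGrowth := by
  classical
  induction s using Finset.induction_on with
  | empty => simp
  | insert a s ha ih =>
    have h := (hf a (by simp)).mul (ih fun i hi => hf i (by simp [hi]))
    refine (funext fun x => ?_ : (fun x => ∏ i ∈ insert a s, f i x) = _) ▸ h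
    simp [Finset.prod_insert ha]

/-- The factor `exp (L x)` is there for completeness, where exponential moments against the Gaussian
are needed; `L = 0` gives the Hermite weight itself. The quadratic exponent absorbs the linear term
by Young's inequality. -/
theorem exists_schwartz_gaussian {d : ℕ} {α : Fin d → ℝ} (hα : ∀ j, 0 < α j) (β : Fin d → ℝ)
    (L : (Fin d → ℝ) →L[ℝ] ℝ) :
    ∃ φ : 𝓢(Fin d → ℝ, ℝ), ∀ x, φ x =
      Real.exp (L x) * ∏ j, Real.exp (-(1 / 2) * α j ^ 2 * (x j - β j) ^ 2) := by
  obtain ⟨c, hc, hcα⟩ : ∃ c : ℝ, 0 < c ∧ ∀ j, c ≤ α j ^ 2 / 4 := by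
    refine ⟨(1 + ∑ j, 4 / α j ^ 2)⁻¹, ?_, fun j => ?_⟩
    · have : 0 ≤ ∑ j, 4 / α j ^ 2 := Finset.sum_nonneg fun j _ => by positivity
      positivity
    · have h1 : 4 / α j ^ 2 ≤ ∑ j, 4 / α j ^ 2 :=
        Finset.single_le_sum (f := fun j => 4 / α j ^ 2) (fun j _ => by positivity)
          (Finset.mem_univ j)
      have h2 := hα j
      rw [← inv_div]
      exact inv_anti₀ (by positivity) (by linarith)
  have hQ : (fun x : Fin d → ℝ =>
      (∑ j, 1 / 2 * α j ^ 2 * (x j - β j) ^ 2) - L x).HasTemperateGrowth := by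
    refine Function.HasTemperateGrowth.sub ?_ L.hasTemperateGrowth
    refine Function.HasTemperateGrowth.sum fun j _ => ?_
    exact (Function.HasTemperateGrowth.const _).mul
      (((hasTemperateGrowth_coord j).sub (Function.HasTemperateGrowth.const _)).pow 2)
  obtain ⟨φ, hφ⟩ := exists_schwartz_exp_neg hQ (c := c / 2)
    (C := (∑ j, 1 / 2 * α j ^ 2 * β j ^ 2) + ‖L‖ ^ 2 / (2 * c)) (by positivity) (by
      intro x
      have h1 : ‖x‖ ^ 2 ≤ ∑ j, x j ^ 2 := by
        have h0 : ‖x‖ ≤ Real.sqrt (∑ j, x j ^ 2) := by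
          refine (pi_norm_le_iff_of_nonneg (Real.sqrt_nonneg _)).2 fun j => ?_
          rw [Real.norm_eq_abs]
          refine Real.abs_le_sqrt ?_
          exact Finset.single_le_sum (f := fun j => x j ^ 2) (fun j _ => sq_nonneg _)
            (Finset.mem_univ j)
        calc ‖x‖ ^ 2 ≤ Real.sqrt (∑ j, x j ^ 2) ^ 2 := by gcongr
          _ = _ := Real.sq_sqrt (Finset.sum_nonneg fun j _ => sq_nonneg _)
      have h2 : c * ∑ j, x j ^ 2 ≤
          (∑ j, 1 / 2 * α j ^ 2 * (x j - β j) ^ 2) + ∑ j, 1 / 2 * α j ^ 2 * β j ^ 2 := by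
        rw [← Finset.sum_add_distrib, Finset.mul_sum]
        refine Finset.sum_le_sum fun j _ => ?_
        have h3 : c * x j ^ 2 ≤ α j ^ 2 / 4 * x j ^ 2 := by
          gcongr
          exact hcα j
        -- The difference of the two sides, with `α j ^ 2 / 4` in place of `c`, is exactly `α j ^ 2
        -- / 4 * (x j - 2 * β j) ^ 2`.
        nlinarith [mul_nonneg (sq_nonneg (α j)) (sq_nonneg (x j - 2 * β j))]
      have h3 : L x ≤ ‖L‖ * ‖x‖ := (Real.le_norm_self _).trans (L.le_opNorm x)
      have h4 : ‖L‖ * ‖x‖ ≤ c / 2 * ‖x‖ ^ 2 + ‖L‖ ^ 2 / (2 * c) := by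
        have : ‖L‖ ^ 2 / (2 * c) - ‖L‖ * ‖x‖ + c / 2 * ‖x‖ ^ 2
            = (‖L‖ - c * ‖x‖) ^ 2 / (2 * c) := by field_simp; ring
        have h5 : 0 ≤ (‖L‖ - c * ‖x‖) ^ 2 / (2 * c) := by positivity
        linarith
      have h6 : c * ‖x‖ ^ 2 ≤ c * ∑ j, x j ^ 2 := by gcongr
      linarith)
  refine ⟨φ, fun x => ?_⟩
  rw [hφ, ← Real.exp_sum, ← Real.exp_add]
  congr 1
  rw [neg_sub, sub_eq_add_neg, ← Finset.sum_neg_distrib]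
  congr 1
  exact Finset.sum_congr rfl fun j _ => by ring

/-! ### One-dimensional Hermite functions -/

theorem hasDerivAt_hermiteH (n : ℕ) (x : ℝ) :
    HasDerivAt (hermiteH n) (2 * x * hermiteH n x - hermiteH (n + 1) x) x := by
  have hg : ContDiff ℝ ∞ fun y : ℝ => Real.exp (-y ^ 2) := by fun_prop
  have h1 : HasDerivAt (iteratedDeriv n fun y : ℝ => Real.exp (-y ^ 2))
      (iteratedDeriv (n + 1) (fun y : ℝ => Real.exp (-y ^ 2)) x) x := by
    rw [iteratedDeriv_succ]
    exact ((hg.differentiable_iteratedDeriv n (by exact_mod_cast ENat.natCast_lt_top n)) x).hasDerivAt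
  have h2 : HasDerivAt (fun x : ℝ => (-1) ^ n * Real.exp (x ^ 2))
      ((-1) ^ n * (Real.exp (x ^ 2) * (2 * x))) x := by
    have := ((hasDerivAt_pow 2 x).exp).const_mul ((-1 : ℝ) ^ n)
    simpa using this
  refine (h2.mul h1).congr_deriv ?_
  simp only [hermiteH, pow_succ]
  ring

theorem hermiteH_zero (x : ℝ) : hermiteH 0 x = 1 := by
  simp [hermiteH, ← Real.exp_add]

theorem hermiteH_one (x : ℝ) : hermiteH 1 x = 2 * x := by
  have h := (hasDerivAt_hermiteH 0 x).unique
    ((hasDerivAt_const x (1 : ℝ)).congr_of_eventuallyEq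
      (Filter.Eventually.of_forall hermiteH_zero))
  rw [hermiteH_zero] at h
  simp only [zero_add] at h
  linarith

/-- Differentiating the recurrence at level `n` and computing each derivative by
`hasDerivAt_hermiteH` yields level `n + 1`, by uniqueness of derivatives. -/
theorem hermiteH_add_two (n : ℕ) (x : ℝ) :
    hermiteH (n + 2) x = 2 * x * hermiteH (n + 1) x - 2 * (n + 1) * hermiteH n x := by
  induction n generalizing x with
  | zero =>
    have h := (hasDerivAt_hermiteH 1 x).unique
      (((hasDerivAt_id x).const_mul 2).congr_of_eventuallyEq
        (Filter.Eventually.of_forall hermiteH_one))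
    simp only [hermiteH_one, hermiteH_zero, zero_add, one_add_one_eq_two, Nat.cast_zero] at h ⊢
    linarith
  | succ n ih =>
    have h1 := hasDerivAt_hermiteH (n + 2) x
    have h2 := (((hasDerivAt_id x).const_mul 2).mul (hasDerivAt_hermiteH (n + 1) x)).sub
      ((hasDerivAt_hermiteH n x).const_mul (2 * ((n : ℝ) + 1)))
    have h := h1.unique (h2.congr_of_eventuallyEq (Filter.Eventually.of_forall ih))
    have h3 := ih x
    simp only [id] at h
    push_cast
    rw [show n + 1 + 2 = n + 2 + 1 from rfl, show n + 1 + 1 = n + 2 from rfl] at *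
    linear_combination -h + 2 * x * h3

theorem hasTemperateGrowth_hermiteH (n : ℕ) : (hermiteH n).HasTemperateGrowth := by
  induction n using Nat.twoStepInduction with
  | zero =>
    rw [funext hermiteH_zero]
    exact Function.HasTemperateGrowth.const _
  | one =>
    rw [funext hermiteH_one]
    exact (Function.HasTemperateGrowth.const _).mul Function.HasTemperateGrowth.id'
  | more n h1 h2 =>
    rw [funext (hermiteH_add_two n)]
    exact (((Function.HasTemperateGrowth.const _).mul Function.HasTemperateGrowth.id').mul h2).sub
      ((Function.HasTemperateGrowth.const _).mul h1)

/-- The normalizing factor of the Hermite functions. -/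
def hermiteNorm (a : ℝ) (n : ℕ) : ℝ :=
  Real.sqrt (a / (2 ^ n * (n.factorial : ℝ) * Real.sqrt Real.pi))

theorem hermiteNorm_succ (a : ℝ) (n : ℕ) :
    Real.sqrt (2 * (n + 1)) * hermiteNorm a (n + 1) = hermiteNorm a n := by
  rw [hermiteNorm, hermiteNorm, ← Real.sqrt_mul (by positivity)]
  congr 1
  rw [Nat.factorial_succ]
  push_cast
  field_simp
  ring

theorem hermiteFun_eq (a b : ℝ) (n : ℕ) (x : ℝ) : hermiteFun a b n x =
    hermiteNorm a n * hermiteH n (a * (x - b)) * Real.exp (-(1 / 2) * a ^ 2 * (x - b) ^ 2) := rfl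

theorem hasDerivAt_hermiteFun (a b : ℝ) (n : ℕ) (x : ℝ) :
    HasDerivAt (hermiteFun a b n)
      (a ^ 2 * (x - b) * hermiteFun a b n x
        - a * Real.sqrt (2 * (n + 1)) * hermiteFun a b (n + 1) x) x := by
  have h0 : HasDerivAt (fun x : ℝ => a * (x - b)) a x := by
    simpa using ((hasDerivAt_id x).sub_const b).const_mul a
  have h1 := ((hasDerivAt_hermiteH n (a * (x - b))).comp x h0).const_mul (hermiteNorm a n)
  have h2 : HasDerivAt (fun x : ℝ => Real.exp (-(1 / 2) * a ^ 2 * (x - b) ^ 2))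
      (Real.exp (-(1 / 2) * a ^ 2 * (x - b) ^ 2) * (-(1 / 2) * a ^ 2 * (2 * (x - b)))) x := by
    have := ((((hasDerivAt_id x).sub_const b).pow 2).const_mul (-(1 / 2) * a ^ 2)).exp
    simpa using this
  refine (h1.mul h2).congr_deriv ?_
  simp only [hermiteFun_eq, Function.comp]
  rw [← hermiteNorm_succ a n]
  ring

theorem hermiteFun_raise (a b : ℝ) (n : ℕ) (x : ℝ) :
    -deriv (hermiteFun a b n) x + a ^ 2 * (x - b) * hermiteFun a b n x
      = a * Real.sqrt (2 * (n + 1)) * hermiteFun a b (n + 1) x := by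
  rw [(hasDerivAt_hermiteFun a b n x).deriv]
  ring

/-- This is the action of `𝒟`, while `hermiteFun_raise` is that of its formal adjoint. For `n = 0`
the truncated index `n - 1 = 0` is harmless because the factor `√(2n)` vanishes. -/
theorem hermiteFun_lower (a b : ℝ) (n : ℕ) (x : ℝ) :
    deriv (hermiteFun a b n) x + a ^ 2 * (x - b) * hermiteFun a b n x
      = a * Real.sqrt (2 * n) * hermiteFun a b (n - 1) x := by
  rw [(hasDerivAt_hermiteFun a b n x).deriv]
  cases n with
  | zero =>
    have h := hermiteNorm_succ a 0
    simp only [hermiteFun_eq, hermiteH_one, hermiteH_zero, zero_add, Nat.cast_zero, mul_zero,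
      Real.sqrt_zero, zero_mul, mul_one] at h ⊢
    rw [← h]
    ring
  | succ n =>
    have h1 := hermiteNorm_succ a n
    have h2 := hermiteNorm_succ a (n + 1)
    have h3 : Real.sqrt (2 * ((n : ℝ) + 1)) ^ 2 = 2 * (n + 1) := Real.sq_sqrt (by positivity)
    simp only [hermiteFun_eq, add_tsub_cancel_right, add_assoc, one_add_one_eq_two,
      hermiteH_add_two n]
    push_cast at h2 ⊢
    rw [← h1, ← h2]
    rw [← h2] at h1
    set E := Real.exp (-(1 / 2) * a ^ 2 * (x - b) ^ 2)
    linear_combination (-a * Real.sqrt (2 * (n + 1 + 1)) * hermiteNorm a (n + 2) * E *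
      hermiteH n (a * (x - b))) * h3

theorem integral_hermiteFun_zero_sq {a : ℝ} (ha : 0 < a) (b : ℝ) :
    ∫ x, hermiteFun a b 0 x * hermiteFun a b 0 x = 1 := by
  have h1 : ∀ x, hermiteFun a b 0 x * hermiteFun a b 0 x
      = a / Real.sqrt Real.pi * Real.exp (-a ^ 2 * (x - b) ^ 2) := by
    intro x
    have h2 : hermiteNorm a 0 * hermiteNorm a 0 = a / Real.sqrt Real.pi := by
      rw [hermiteNorm, Real.mul_self_sqrt (by positivity)]
      simp
    simp only [hermiteFun_eq, hermiteH_zero, mul_one]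
    rw [mul_mul_mul_comm, h2, ← Real.exp_add]
    ring_nf
  simp_rw [h1]
  rw [integral_const_mul, integral_sub_right_eq_self (fun x => Real.exp (-a ^ 2 * x ^ 2)) b,
    integral_gaussian, Real.sqrt_div Real.pi_pos.le, Real.sqrt_sq ha.le]
  have : Real.sqrt Real.pi ≠ 0 := (Real.sqrt_pos.2 Real.pi_pos).ne'
  field_simp

/-! ### Tensorial Hermite functions -/

theorem multiIndex_induction {d : ℕ} {p : (Fin d → ℕ) → Prop} (h0 : p 0)
    (hs : ∀ n j, p n → p (n + Pi.single j 1)) (n : Fin d → ℕ) : p n := by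
  induction h : ∑ j, n j generalizing n with
  | zero =>
    have : n = 0 := by
      funext j
      exact (Finset.sum_eq_zero_iff.1 h) j (Finset.mem_univ j)
    exact this ▸ h0
  | succ s ih =>
    obtain ⟨j, -, hj⟩ : ∃ j ∈ Finset.univ, n j ≠ 0 := by
      refine Finset.exists_ne_zero_of_sum_ne_zero (by omega)
    have hle : Pi.single j 1 ≤ n := by
      intro i
      by_cases hi : i = j
      · subst hi; simpa using Nat.one_le_iff_ne_zero.2 hj
      · simp [hi]
    have hn : n - Pi.single j 1 + Pi.single j 1 = n := tsub_add_cancel_of_le hle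
    rw [← hn]
    refine hs _ _ (ih _ ?_)
    have h2 : ∑ i, (n - Pi.single j 1 + Pi.single j 1 : Fin d → ℕ) i = s + 1 := by rw [hn, h]
    simp only [Pi.add_apply, Finset.sum_add_distrib, Finset.sum_pi_single', Finset.mem_univ,
      if_true] at h2
    omega

theorem exists_schwartz_hermiteTensor {d : ℕ} {α : Fin d → ℝ} (hα : ∀ j, 0 < α j)
    (β : Fin d → ℝ) (n : Fin d → ℕ) :
    ∃ φ : 𝓢(Fin d → ℝ, ℝ), ∀ x, φ x = hermiteTensor α β n x := by
  obtain ⟨φ, hφ⟩ := exists_schwartz_gaussian hα β 0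
  have hg : (fun x : Fin d → ℝ =>
      ∏ j, hermiteNorm (α j) (n j) * hermiteH (n j) (α j * (x j - β j))).HasTemperateGrowth := by
    refine hasTemperateGrowth_finset_prod _ fun j _ => ?_
    have h : (fun x : Fin d → ℝ => α j * (x j - β j)).HasTemperateGrowth :=
      (Function.HasTemperateGrowth.const (E := Fin d → ℝ) (α j)).mul
        ((hasTemperateGrowth_coord j).sub (Function.HasTemperateGrowth.const _))
    exact (Function.HasTemperateGrowth.const (E := Fin d → ℝ) (hermiteNorm (α j) (n j))).mul
      ((hasTemperateGrowth_hermiteH (n j)).comp h)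
  refine ⟨SchwartzMap.smulLeftCLM ℝ (fun x : Fin d → ℝ =>
    ∏ j, hermiteNorm (α j) (n j) * hermiteH (n j) (α j * (x j - β j))) φ, fun x => ?_⟩
  rw [SchwartzMap.smulLeftCLM_apply_apply hg, hφ]
  simp only [zero_apply, Real.exp_zero, one_mul, smul_eq_mul,
    ← Finset.prod_mul_distrib]
  rfl

section Tensor

variable {d : ℕ} {α : Fin d → ℝ} (hα : ∀ j, 0 < α j) (β : Fin d → ℝ)

/-- The tensorial Hermite functions as Schwartz functions. -/
def hermiteSchwartz (n : Fin d → ℕ) : 𝓢(Fin d → ℝ, ℝ) :=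
  (exists_schwartz_hermiteTensor hα β n).choose

theorem hermiteSchwartz_apply (n : Fin d → ℕ) (x : Fin d → ℝ) :
    hermiteSchwartz hα β n x = hermiteTensor α β n x :=
  (exists_schwartz_hermiteTensor hα β n).choose_spec x

theorem hermiteSchwartz_eq_mul (n : Fin d → ℕ) (j : Fin d) (x : Fin d → ℝ) :
    hermiteSchwartz hα β n x = hermiteFun (α j) (β j) (n j) (x j) *
      ∏ i ∈ Finset.univ.erase j, hermiteFun (α i) (β i) (n i) (x i) := by
  rw [hermiteSchwartz_apply, hermiteTensor]
  exact (Finset.mul_prod_erase Finset.univ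
    (fun i => hermiteFun (α i) (β i) (n i) (x i)) (Finset.mem_univ j)).symm

theorem fderiv_hermiteSchwartz (n : Fin d → ℕ) (j : Fin d) (x : Fin d → ℝ) :
    fderiv ℝ (hermiteSchwartz hα β n) x (Pi.single j 1) =
      deriv (hermiteFun (α j) (β j) (n j)) (x j) *
        ∏ i ∈ Finset.univ.erase j, hermiteFun (α i) (β i) (n i) (x i) := by
  rw [← (hermiteSchwartz hα β n).differentiableAt.lineDeriv_eq_fderiv, lineDeriv]
  have h : (fun t : ℝ => hermiteSchwartz hα β n (x + t • Pi.single j 1)) = fun t =>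
      hermiteFun (α j) (β j) (n j) (x j + t) *
        ∏ i ∈ Finset.univ.erase j, hermiteFun (α i) (β i) (n i) (x i) := by
    funext t
    rw [hermiteSchwartz_eq_mul hα β n j]
    congr 1
    · simp
    · refine Finset.prod_congr rfl fun i hi => ?_
      simp [Finset.ne_of_mem_erase hi]
  rw [h, deriv_mul_const_field, deriv_comp_const_add, add_zero]

theorem hermiteSchwartz_raise (n : Fin d → ℕ) (j : Fin d) (x : Fin d → ℝ) :
    -(fderiv ℝ (hermiteSchwartz hα β n) x (Pi.single j 1))
        + α j ^ 2 * (x j - β j) * hermiteSchwartz hα β n x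
      = α j * Real.sqrt (2 * (n j + 1)) * hermiteSchwartz hα β (n + Pi.single j 1) x := by
  rw [fderiv_hermiteSchwartz, hermiteSchwartz_eq_mul hα β n j,
    hermiteSchwartz_eq_mul hα β (n + Pi.single j 1) j]
  have h : ∏ i ∈ Finset.univ.erase j, hermiteFun (α i) (β i) ((n + Pi.single j 1 : Fin d → ℕ) i) (x i) =
      ∏ i ∈ Finset.univ.erase j, hermiteFun (α i) (β i) (n i) (x i) := by
    refine Finset.prod_congr rfl fun i hi => ?_
    simp [Finset.ne_of_mem_erase hi]
  rw [h]
  have h2 := hermiteFun_raise (α j) (β j) (n j) (x j)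
  simp only [Pi.add_apply, Pi.single_eq_same]
  linear_combination (∏ i ∈ Finset.univ.erase j, hermiteFun (α i) (β i) (n i) (x i)) * h2

theorem hermiteSchwartz_lower (n : Fin d → ℕ) (j : Fin d) (x : Fin d → ℝ) :
    fderiv ℝ (hermiteSchwartz hα β n) x (Pi.single j 1)
        + α j ^ 2 * (x j - β j) * hermiteSchwartz hα β n x
      = α j * Real.sqrt (2 * n j) * hermiteSchwartz hα β (n - Pi.single j 1) x := by
  rw [fderiv_hermiteSchwartz, hermiteSchwartz_eq_mul hα β n j,
    hermiteSchwartz_eq_mul hα β (n - Pi.single j 1) j]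
  have h : ∏ i ∈ Finset.univ.erase j, hermiteFun (α i) (β i) ((n - Pi.single j 1 : Fin d → ℕ) i) (x i) =
      ∏ i ∈ Finset.univ.erase j, hermiteFun (α i) (β i) (n i) (x i) := by
    refine Finset.prod_congr rfl fun i hi => ?_
    simp [Finset.ne_of_mem_erase hi]
  rw [h]
  have h2 := hermiteFun_lower (α j) (β j) (n j) (x j)
  simp only [Pi.sub_apply, Pi.single_eq_same]
  linear_combination (∏ i ∈ Finset.univ.erase j, hermiteFun (α i) (β i) (n i) (x i)) * h2

theorem integral_mul_fderiv_eq_neg (j : Fin d) (φ ψ : 𝓢(Fin d → ℝ, ℝ)) :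
    ∫ x, φ x * fderiv ℝ ψ x (Pi.single j 1) = -∫ x, fderiv ℝ φ x (Pi.single j 1) * ψ x :=
  SchwartzMap.integral_mul_lineDerivOp_right_eq_neg_left φ ψ (Pi.single j 1)

theorem integrable_schwartz_mul (φ ψ : 𝓢(Fin d → ℝ, ℝ)) : Integrable fun x => φ x * ψ x :=
  (φ.memLp 2).integrable_mul (ψ.memLp 2)

/-- Integration by parts: the raising operator `-∂_j + α_j² (x_j - β_j)` is the adjoint of the
lowering operator `∂_j + α_j² (x_j - β_j)`. -/
theorem integral_raise_mul_eq_integral_mul_lower (n n' : Fin d → ℕ) (j : Fin d) :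
    α j * Real.sqrt (2 * (n j + 1)) *
        ∫ x, hermiteSchwartz hα β (n + Pi.single j 1) x * hermiteSchwartz hα β n' x
      = α j * Real.sqrt (2 * n' j) *
        ∫ x, hermiteSchwartz hα β n x * hermiteSchwartz hα β (n' - Pi.single j 1) x := by
  have h := integral_mul_fderiv_eq_neg j (hermiteSchwartz hα β n) (hermiteSchwartz hα β n')
  have i1 : Integrable fun x =>
      hermiteSchwartz hα β n x * fderiv ℝ (hermiteSchwartz hα β n') x (Pi.single j 1) :=
    integrable_schwartz_mul (hermiteSchwartz hα β n)
      (LineDeriv.lineDerivOp (Pi.single j (1 : ℝ) : Fin d → ℝ) (hermiteSchwartz hα β n'))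
  have i2 : Integrable fun x =>
      fderiv ℝ (hermiteSchwartz hα β n) x (Pi.single j 1) * hermiteSchwartz hα β n' x :=
    integrable_schwartz_mul
      (LineDeriv.lineDerivOp (Pi.single j (1 : ℝ) : Fin d → ℝ) (hermiteSchwartz hα β n))
      (hermiteSchwartz hα β n')
  have i3 := (integrable_schwartz_mul (hermiteSchwartz hα β (n + Pi.single j 1))
    (hermiteSchwartz hα β n')).const_mul (α j * Real.sqrt (2 * (n j + 1)))
  have i4 := (integrable_schwartz_mul (hermiteSchwartz hα β n)
    (hermiteSchwartz hα β (n' - Pi.single j 1))).const_mul (α j * Real.sqrt (2 * n' j))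
  rw [← sub_eq_zero] at h ⊢
  rw [sub_neg_eq_add, ← integral_add i1 i2] at h
  rw [← integral_const_mul, ← integral_const_mul, ← integral_sub i3 i4, ← neg_eq_zero,
    ← integral_neg, ← h]
  refine integral_congr_ae (Filter.Eventually.of_forall fun x => ?_)
  have h1 := hermiteSchwartz_raise hα β n j x
  have h2 := hermiteSchwartz_lower hα β n' j x
  simp only
  linear_combination hermiteSchwartz hα β n' x * h1 - hermiteSchwartz hα β n x * h2

theorem integral_hermiteSchwartz_zero_sq :
    ∫ x, hermiteSchwartz hα β 0 x * hermiteSchwartz hα β 0 x = 1 := by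
  simp only [hermiteSchwartz_apply, hermiteTensor, ← Finset.prod_mul_distrib, Pi.zero_apply]
  rw [integral_fintype_prod_volume_eq_prod
    (fun j (y : ℝ) => hermiteFun (α j) (β j) 0 y * hermiteFun (α j) (β j) 0 y)]
  simp [integral_hermiteFun_zero_sq (hα _)]

/-- Adjointness lowers `n j` and `n' j` together, which drives an induction on the multi-index. If
one of the two entries reaches zero first, the factor `√0` makes the integral vanish (`hzero`). -/
theorem integral_hermiteSchwartz_mul (n n' : Fin d → ℕ) :
    ∫ x, hermiteSchwartz hα β n x * hermiteSchwartz hα β n' x = if n = n' then 1 else 0 := by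
  have hpos : ∀ (n : Fin d → ℕ) (j : Fin d), α j * Real.sqrt (2 * ((n j : ℝ) + 1)) ≠ 0 :=
    fun n j => (mul_pos (hα j) (Real.sqrt_pos.2 (by positivity))).ne'
  have hzero : ∀ (n n' : Fin d → ℕ) (j : Fin d), n' j = 0 →
      ∫ x, hermiteSchwartz hα β (n + Pi.single j 1) x * hermiteSchwartz hα β n' x = 0 := by
    intro n n' j h0
    have h := integral_raise_mul_eq_integral_mul_lower hα β n n' j
    rw [h0] at h
    rw [Nat.cast_zero, mul_zero, Real.sqrt_zero, mul_zero, zero_mul] at h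
    exact (mul_eq_zero.1 h).resolve_left (hpos n j)
  induction n using multiIndex_induction generalizing n' with
  | h0 =>
    induction n' using multiIndex_induction with
    | h0 => simpa using integral_hermiteSchwartz_zero_sq hα β
    | hs n' j _ =>
      rw [if_neg, ← hzero n' 0 j rfl]
      · simp only [mul_comm]
      · intro h
        simpa using congrFun h j
  | hs n j ih =>
    by_cases h0 : n' j = 0
    · rw [hzero n n' j h0, if_neg]
      intro h
      have := congrFun h j
      simp [h0] at this
    · have hn' : n' - Pi.single j 1 + Pi.single j 1 = n' := by
        refine tsub_add_cancel_of_le fun i => ?_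
        by_cases hi : i = j
        · subst hi; simpa using Nat.one_le_iff_ne_zero.2 h0
        · simp [hi]
      have h := integral_raise_mul_eq_integral_mul_lower hα β n n' j
      rw [ih] at h
      by_cases hn : n + Pi.single j 1 = n'
      · have h1 : n = n' - Pi.single j 1 := by rw [← hn, add_tsub_cancel_right]
        rw [if_pos h1, ← hn] at h
        rw [if_pos hn, ← hn]
        simp only [Pi.add_apply, Pi.single_eq_same, Nat.cast_add, Nat.cast_one, mul_one] at h
        exact mul_left_cancel₀ (hpos n j) (h.trans (mul_one _).symm)
      · have h1 : n ≠ n' - Pi.single j 1 := by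
          intro h1
          exact hn (by rw [h1, hn'])
        rw [if_neg h1, mul_zero] at h
        rw [if_neg hn]
        exact (mul_eq_zero.1 h).resolve_left (hpos n j)

/-! ### Completeness -/

/-- The span of the Hermite functions, as a space of functions. -/
def hermiteSpan : Submodule ℝ ((Fin d → ℝ) → ℝ) :=
  Submodule.span ℝ (Set.range fun n => (hermiteSchwartz hα β n : (Fin d → ℝ) → ℝ))

theorem hermiteSchwartz_mem_hermiteSpan (n : Fin d → ℕ) :
    (hermiteSchwartz hα β n : (Fin d → ℝ) → ℝ) ∈ hermiteSpan hα β :=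
  Submodule.subset_span ⟨n, rfl⟩

/-- Adding the raising and lowering relations cancels the derivative and expresses multiplication by
`x_j` through neighbouring Hermite functions. -/
theorem coord_mul_mem_hermiteSpan (j : Fin d) {g : (Fin d → ℝ) → ℝ} (hg : g ∈ hermiteSpan hα β) :
    (fun x => x j * g x) ∈ hermiteSpan hα β := by
  refine Submodule.span_induction ?_ ?_ ?_ ?_ hg
  · rintro _ ⟨n, rfl⟩
    have h : (fun x => x j * hermiteSchwartz hα β n x) =
        β j • (hermiteSchwartz hα β n : (Fin d → ℝ) → ℝ)
        + (Real.sqrt (2 * (n j + 1)) / (2 * α j)) •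
          (hermiteSchwartz hα β (n + Pi.single j 1) : (Fin d → ℝ) → ℝ)
        + (Real.sqrt (2 * n j) / (2 * α j)) •
          (hermiteSchwartz hα β (n - Pi.single j 1) : (Fin d → ℝ) → ℝ) := by
      funext x
      have h1 := hermiteSchwartz_raise hα β n j x
      have h2 := hermiteSchwartz_lower hα β n j x
      have h3 := (hα j).ne'
      simp only [Pi.add_apply, Pi.smul_apply, smul_eq_mul]
      field_simp
      refine mul_left_cancel₀ h3 ?_
      linear_combination h1 + h2
    simp only
    rw [h]
    exact add_mem (add_mem (Submodule.smul_mem _ _ (hermiteSchwartz_mem_hermiteSpan hα β _))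
      (Submodule.smul_mem _ _ (hermiteSchwartz_mem_hermiteSpan hα β _)))
      (Submodule.smul_mem _ _ (hermiteSchwartz_mem_hermiteSpan hα β _))
  · simp only [Pi.zero_apply, mul_zero]
    exact Submodule.zero_mem (hermiteSpan hα β)
  · intro f g _ _ hf hg
    convert! add_mem hf hg using 1
    funext x
    simp [mul_add]
  · intro c f _ hf
    convert! Submodule.smul_mem _ c hf using 1
    funext x
    simp only [Pi.smul_apply, smul_eq_mul]
    ring

theorem pow_mul_mem_hermiteSpan (L : (Fin d → ℝ) →L[ℝ] ℝ) (k : ℕ) :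
    (fun x => L x ^ k * hermiteSchwartz hα β 0 x) ∈ hermiteSpan hα β := by
  induction k with
  | zero => simpa using hermiteSchwartz_mem_hermiteSpan hα β 0
  | succ k ih =>
    have h : (fun x => L x ^ (k + 1) * hermiteSchwartz hα β 0 x) =
        ∑ j, L (Pi.single j 1) • fun x => x j * (L x ^ k * hermiteSchwartz hα β 0 x) := by
      funext x
      have hL : L x = ∑ j, L (Pi.single j 1) * x j := by
        conv_lhs => rw [← LinearMap.sum_single_apply (fun _ => ℝ) x]
        rw [map_sum]
        refine Finset.sum_congr rfl fun j _ => ?_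
        have : Pi.single j (x j) = x j • (Pi.single j 1 : Fin d → ℝ) := by
          rw [← Pi.single_smul]; simp
        rw [this, map_smul, smul_eq_mul, mul_comm]
      simp only [Finset.sum_apply, Pi.smul_apply, smul_eq_mul]
      rw [pow_succ, mul_assoc, mul_left_comm]
      nth_rewrite 1 [hL]
      rw [Finset.sum_mul]
      exact Finset.sum_congr rfl fun j _ => by ring
    rw [h]
    exact Submodule.sum_mem _ fun j _ =>
      Submodule.smul_mem _ _ (coord_mul_mem_hermiteSpan hα β j ih)

theorem integral_mul_eq_zero_of_mem_hermiteSpan {u : L2 d}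
    (hu : ∀ n, ∫ x, u x * hermiteSchwartz hα β n x = 0) {g : (Fin d → ℝ) → ℝ}
    (hg : g ∈ hermiteSpan hα β) :
    Integrable (fun x => u x * g x) ∧ ∫ x, u x * g x = 0 := by
  refine Submodule.span_induction ?_ ?_ ?_ ?_ hg
  · rintro _ ⟨n, rfl⟩
    exact ⟨integrable_mul_schwartz u _, hu n⟩
  · simp
  · rintro f g _ _ ⟨hf, hf'⟩ ⟨hg, hg'⟩
    simp only [Pi.add_apply, mul_add]
    exact ⟨hf.add hg, by rw [integral_add hf hg, hf', hg', add_zero]⟩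
  · rintro c f _ ⟨hf, hf'⟩
    simp only [Pi.smul_apply, smul_eq_mul, mul_left_comm _ c]
    exact ⟨hf.const_mul c, by rw [integral_const_mul, hf', mul_zero]⟩

theorem hermiteSchwartz_zero_apply (x : Fin d → ℝ) : hermiteSchwartz hα β 0 x =
    (∏ j, hermiteNorm (α j) 0) * ∏ j, Real.exp (-(1 / 2) * α j ^ 2 * (x j - β j) ^ 2) := by
  rw [hermiteSchwartz_apply, hermiteTensor, ← Finset.prod_mul_distrib]
  refine Finset.prod_congr rfl fun j _ => ?_
  rw [hermiteFun_eq, Pi.zero_apply, hermiteH_zero, mul_one]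

theorem hermiteSchwartz_zero_pos (x : Fin d → ℝ) : 0 < hermiteSchwartz hα β 0 x := by
  rw [hermiteSchwartz_zero_apply]
  refine mul_pos (Finset.prod_pos fun j _ => ?_) (Finset.prod_pos fun j _ => Real.exp_pos _)
  have := hα j
  exact Real.sqrt_pos.2 (by positivity)

/-- Domination by `exp |L| ≤ exp L + exp (-L)`, each factor being absorbed into a Schwartz Gaussian.
This is the majorant for the termwise integration in `integral_mul_cexp_eq_zero`. -/
theorem integrable_mul_gaussian_mul_exp_abs (u : L2 d) (L : (Fin d → ℝ) →L[ℝ] ℝ) :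
    Integrable fun x => |u x * hermiteSchwartz hα β 0 x| * Real.exp |L x| := by
  obtain ⟨φ, hφ⟩ := exists_schwartz_gaussian hα β L
  obtain ⟨ψ, hψ⟩ := exists_schwartz_gaussian hα β (-L)
  have hi := ((integrable_mul_schwartz u φ).norm.add
    (integrable_mul_schwartz u ψ).norm).const_mul (∏ j, hermiteNorm (α j) 0)
  have hN : 0 ≤ ∏ j, hermiteNorm (α j) 0 := Finset.prod_nonneg fun j _ => Real.sqrt_nonneg _
  refine hi.mono' ?_ (Filter.Eventually.of_forall fun x => ?_)
  · refine AEStronglyMeasurable.mul ?_ ?_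
    · exact (integrable_mul_schwartz u _).1.norm
    · exact (Real.continuous_exp.comp L.continuous.abs).aestronglyMeasurable
  · have hG : 0 ≤ ∏ j, Real.exp (-(1 / 2) * α j ^ 2 * (x j - β j) ^ 2) :=
      Finset.prod_nonneg fun j _ => (Real.exp_pos _).le
    simp only [Pi.add_apply, norm_mul, Real.norm_eq_abs, abs_mul, abs_abs, hφ, hψ,
      Real.abs_exp, hermiteSchwartz_zero_apply, abs_of_nonneg hN, abs_of_nonneg hG,
      neg_apply]
    have h1 : Real.exp |L x| ≤ Real.exp (L x) + Real.exp (-L x) := by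
      rcases abs_cases (L x) with ⟨h, _⟩ | ⟨h, _⟩ <;> rw [h]
      · linarith [Real.exp_pos (-L x)]
      · linarith [Real.exp_pos (L x)]
    set G := ∏ j, Real.exp (-(1 / 2) * α j ^ 2 * (x j - β j) ^ 2)
    set M := ∏ j, hermiteNorm (α j) 0
    calc |u x| * (M * G) * Real.exp |L x|
        ≤ |u x| * (M * G) * (Real.exp (L x) + Real.exp (-L x)) := by gcongr
      _ = _ := by ring

/-- Expanding `exp (i L x)` in powers of `L x` and integrating termwise, each term is a polynomial
moment of `u` against the Gaussian. It vanishes because polynomial times Gaussian lies in the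
Hermite span. -/
theorem integral_mul_cexp_eq_zero {u : L2 d}
    (hu : ∀ n, ∫ x, u x * hermiteSchwartz hα β n x = 0) (L : (Fin d → ℝ) →L[ℝ] ℝ) :
    ∫ x, ((u x * hermiteSchwartz hα β 0 x : ℝ) : ℂ) * Complex.exp (L x * Complex.I) = 0 := by
  set g : (Fin d → ℝ) → ℝ := fun x => u x * hermiteSchwartz hα β 0 x with hg
  have hgm : AEStronglyMeasurable g volume := (integrable_mul_schwartz u _).1
  have hexp : ∀ x, HasSum (fun k : ℕ => |g x| * (|L x| ^ k / k.factorial))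
      (|g x| * Real.exp |L x|) := fun x => by
    have := NormedSpace.expSeries_div_hasSum_exp (𝔸 := ℝ) |L x|
    rw [← Real.exp_eq_exp_ℝ] at this
    exact this.mul_left _
  have hs := hasSum_integral_of_dominated_convergence (μ := volume)
    (F := fun (k : ℕ) x => (g x : ℂ) * ((L x * Complex.I) ^ k / k.factorial))
    (f := fun x => (g x : ℂ) * Complex.exp (L x * Complex.I))
    (fun k x => |g x| * (|L x| ^ k / k.factorial)) ?_ ?_ ?_ ?_ ?_
  · have h0 : ∀ k : ℕ, ∫ x, (g x : ℂ) * ((L x * Complex.I) ^ k / k.factorial) = 0 := by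
      intro k
      have h1 := (integral_mul_eq_zero_of_mem_hermiteSpan hα β hu
        (pow_mul_mem_hermiteSpan hα β L k)).2
      have h2 : ∀ x, (g x : ℂ) * ((L x * Complex.I) ^ k / k.factorial) =
          (Complex.I ^ k / k.factorial) *
            ((u x * (L x ^ k * hermiteSchwartz hα β 0 x) : ℝ) : ℂ) := by
        intro x
        simp only [hg]
        push_cast
        ring
      simp_rw [h2]
      rw [integral_const_mul, integral_complex_ofReal, h1]
      simp
    simp only [h0] at hs
    exact hs.unique hasSum_zero
  · intro k
    exact (Complex.continuous_ofReal.comp_aestronglyMeasurable hgm).mul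
      (by fun_prop : Continuous fun x => ((L x : ℂ) * Complex.I) ^ k /
        (k.factorial : ℂ)).aestronglyMeasurable
  · intro k
    refine Filter.Eventually.of_forall fun x => ?_
    simp
  · exact Filter.Eventually.of_forall fun x => (hexp x).summable
  · simp_rw [fun x => (hexp x).tsum_eq]
    exact integrable_mul_gaussian_mul_exp_abs hα β u L
  · refine Filter.Eventually.of_forall fun x => ?_
    have := NormedSpace.expSeries_div_hasSum_exp (𝔸 := ℂ) (L x * Complex.I)
    rw [← Complex.exp_eq_exp_ℂ] at this
    exact this.mul_left _

/-- An integrable function whose characteristic function vanishes is zero. -/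
theorem ae_eq_zero_of_integral_mul_cexp_eq_zero {E : Type*} [NormedAddCommGroup E]
    [NormedSpace ℝ E] [CompleteSpace E] [MeasurableSpace E] [BorelSpace E]
    [SecondCountableTopology E] {μ : Measure E} {g : E → ℝ} (hg : Integrable g μ)
    (h : ∀ L : E →L[ℝ] ℝ, ∫ x, (g x : ℂ) * Complex.exp (L x * Complex.I) ∂μ = 0) :
    g =ᵐ[μ] 0 := by
  have hm : ∀ {f : E → ℝ}, Integrable f μ →
      AEMeasurable (fun x => ((f x).toNNReal : ENNReal)) μ :=
    fun hf => hf.1.aemeasurable.real_toNNReal.coe_nnreal_ennreal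
  have hfin : ∀ {f : E → ℝ}, Integrable f μ →
      IsFiniteMeasure (μ.withDensity fun x => ((f x).toNNReal : ENNReal)) :=
    fun hf => isFiniteMeasure_withDensity_ofReal hf.2
  have hchar : ∀ {f : E → ℝ}, Integrable f μ → ∀ L : E →L[ℝ] ℝ,
      charFunDual (μ.withDensity fun x => ((f x).toNNReal : ENNReal)) L =
        ∫ x, (((f x).toNNReal : ℝ) : ℂ) * Complex.exp (L x * Complex.I) ∂μ := by
    intro f hf L
    rw [charFunDual_apply, integral_withDensity_eq_integral_smul₀ hf.1.aemeasurable.real_toNNReal]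
    rfl
  have hint : ∀ {f : E → ℝ}, Integrable f μ → ∀ L : E →L[ℝ] ℝ,
      Integrable (fun x => (((f x).toNNReal : ℝ) : ℂ) * Complex.exp (L x * Complex.I)) μ := by
    intro f hf L
    refine Integrable.mul_bdd (c := 1) (hf.real_toNNReal.ofReal) ?_ ?_
    · exact (by fun_prop : Continuous fun x => Complex.exp (L x * Complex.I)).aestronglyMeasurable
    · exact Filter.Eventually.of_forall fun x => by rw [Complex.norm_exp_ofReal_mul_I]
  have := hfin hg
  have := hfin hg.neg
  -- The positive and negative parts of `g` are densities of finite measures with the same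
  -- characteristic function, hence of the same measure.
  have heq : (μ.withDensity fun x => ((g x).toNNReal : ENNReal)) =
      μ.withDensity fun x => (((-g) x).toNNReal : ENNReal) := by
    refine Measure.ext_of_charFunDual (funext fun L => ?_)
    rw [hchar hg, hchar hg.neg, ← sub_eq_zero, ← integral_sub (hint hg L) (hint hg.neg L), ← h L]
    refine integral_congr_ae (Filter.Eventually.of_forall fun x => ?_)
    simp only [Pi.neg_apply, Real.coe_toNNReal']
    rw [← sub_mul, ← Complex.ofReal_sub, max_zero_sub_max_neg_zero_eq_self]
  have hlt : ∫⁻ x, ((g x).toNNReal : ENNReal) ∂μ ≠ ⊤ := by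
    have := measure_ne_top (μ.withDensity fun x => ((g x).toNNReal : ENNReal)) Set.univ
    rwa [withDensity_apply _ MeasurableSet.univ, Measure.restrict_univ] at this
  rw [withDensity_eq_iff (hm hg) (hm hg.neg) hlt] at heq
  filter_upwards [heq] with x hx
  have h1 : ((g x).toNNReal : ℝ) = ((-g x).toNNReal : ℝ) := by
    exact_mod_cast ENNReal.coe_inj.1 hx
  rw [Real.coe_toNNReal', Real.coe_toNNReal'] at h1
  have := max_zero_sub_max_neg_zero_eq_self (g x)
  simp only [Pi.zero_apply]
  linarith

theorem eq_zero_of_forall_integral_hermiteSchwartz_eq_zero {u : L2 d}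
    (hu : ∀ n, ∫ x, u x * hermiteSchwartz hα β n x = 0) : u = 0 := by
  have h := ae_eq_zero_of_integral_mul_cexp_eq_zero
    (integrable_mul_schwartz u (hermiteSchwartz hα β 0)) (integral_mul_cexp_eq_zero hα β hu)
  rw [Lp.eq_zero_iff_ae_eq_zero]
  filter_upwards [h] with x hx
  exact (mul_eq_zero.1 hx).resolve_right (hermiteSchwartz_zero_pos hα β x).ne'

/-! ### The Hermite basis of `L²(ℝᵈ)` -/

theorem inner_toLp (u : L2 d) (φ : 𝓢(Fin d → ℝ, ℝ)) :
    inner ℝ (φ.toLp 2) u = ∫ x, u x * φ x := by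
  rw [L2.inner_def]
  refine integral_congr_ae ?_
  filter_upwards [φ.coeFn_toLp 2] with x hx
  rw [hx]
  simp

theorem orthonormal_hermite :
    Orthonormal ℝ fun n => ((hermiteSchwartz hα β n).toLp 2 : L2 d) := by
  rw [orthonormal_iff_ite]
  intro n n'
  rw [inner_toLp, ← integral_hermiteSchwartz_mul hα β n n']
  refine integral_congr_ae ?_
  filter_upwards [(hermiteSchwartz hα β n').coeFn_toLp 2] with x hx
  rw [hx, mul_comm]

/-- The Hilbert basis of `L²(ℝᵈ)` formed by the Hermite functions. -/
def hermiteBasis : HilbertBasis (Fin d → ℕ) ℝ (L2 d) :=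
  HilbertBasis.mkOfOrthogonalEqBot (orthonormal_hermite hα β) <| by
    rw [Submodule.eq_bot_iff]
    intro u hu
    refine eq_zero_of_forall_integral_hermiteSchwartz_eq_zero hα β fun n => ?_
    rw [← inner_toLp]
    exact hu _ (Submodule.subset_span ⟨n, rfl⟩)

theorem hermiteBasis_apply (n : Fin d → ℕ) :
    hermiteBasis hα β n = (hermiteSchwartz hα β n).toLp 2 := by
  rw [hermiteBasis, HilbertBasis.coe_mkOfOrthogonalEqBot]

theorem inner_hermiteBasis (n : Fin d → ℕ) (u : L2 d) :
    inner ℝ (hermiteBasis hα β n) u = ∫ x, u x * hermiteSchwartz hα β n x := by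
  rw [hermiteBasis_apply, inner_toLp]

theorem hasSum_sq_inner_hermiteBasis (u : L2 d) :
    HasSum (fun n => inner ℝ (hermiteBasis hα β n) u ^ 2) (‖u‖ ^ 2) := by
  have h := (hermiteBasis hα β).hasSum_inner_mul_inner u u
  rw [real_inner_self_eq_norm_sq] at h
  refine h.congr_fun ?_
  intro n
  rw [real_inner_comm, sq]

end Tensor

/-! ### Hyperbolic crosses -/

theorem le_supNorm {d : ℕ} (n : Fin d → ℕ) (j : Fin d) : n j ≤ supNorm n :=
  Finset.le_sup (Finset.mem_univ j)

theorem supNorm_le_mixNorm {d : ℕ} (n : Fin d → ℕ) : supNorm n ≤ mixNorm n := by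
  refine Finset.sup_le fun j _ => (le_max_right 1 (n j)).trans ?_
  exact Finset.single_le_prod' (f := fun j => max 1 (n j)) (fun i _ => le_max_left _ _)
    (Finset.mem_univ j)

theorem supNorm_pos {d : ℕ} {n : Fin d → ℕ} (hn : n ≠ 0) : 1 ≤ supNorm n := by
  obtain ⟨j, hj⟩ := Function.ne_iff.1 hn
  exact (Nat.one_le_iff_ne_zero.2 hj).trans (le_supNorm n j)

theorem finite_hyperbolicCross (d N : ℕ) {γ : ℝ} (hγ : γ < 1) :
    (hyperbolicCross d N γ).Finite := by
  refine (Set.finite_Iic (fun _ : Fin d => N)).subset fun n hn j => ?_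
  by_cases h0 : n = 0
  · simp [h0]
  · have h := hn.resolve_left h0
    have hs : (1 : ℝ) ≤ supNorm n := by exact_mod_cast supNorm_pos h0
    have hM : (supNorm n : ℝ) ≤ mixNorm n := by exact_mod_cast supNorm_le_mixNorm n
    have h1 : (supNorm n : ℝ) ^ (1 - γ) ≤ (N : ℝ) ^ (1 - γ) := by
      refine le_trans ?_ h
      rw [sub_eq_add_neg, Real.rpow_add (by linarith), Real.rpow_one]
      gcongr
    have h2 : (supNorm n : ℝ) ≤ N :=
      (Real.rpow_le_rpow_iff (by positivity) (by positivity) (by linarith)).1 h1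
    exact (le_supNorm n j).trans (by exact_mod_cast h2)

/-- With `X`, `Y`, `Z` the logarithms of `|n|_mix`, `|n|_∞`, `N`, the claim multiplied by `1 - γ >
0` is the sum of `(1 - mγ)(X - Y) ≥ 0` and `(m - 1)(X - γY - (1 - γ)Z) ≥ 0`. The first uses `γ ≤
1/m` and `|n|_∞ ≤ |n|_mix`, the second that `n` is outside the cross. -/
theorem supNorm_le_of_notMem_hyperbolicCross {d m N : ℕ} (hm : 1 ≤ m) {γ : ℝ}
    (hγ : γ ≤ 1 / (m : ℝ)) (hγ1 : γ < 1) (hN : 1 ≤ N) {n : Fin d → ℕ}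
    (hn : n ∉ hyperbolicCross d N γ) :
    (supNorm n : ℝ) ≤ (N : ℝ) ^ (1 - (m : ℝ)) * (mixNorm n : ℝ) ^ m := by
  simp only [hyperbolicCross, Set.mem_ofPred_eq, not_or, not_le] at hn
  obtain ⟨h0, h⟩ := hn
  have hs : (0 : ℝ) < supNorm n := by exact_mod_cast supNorm_pos h0
  have hM : (supNorm n : ℝ) ≤ mixNorm n := by exact_mod_cast supNorm_le_mixNorm n
  have hM0 : (0 : ℝ) < mixNorm n := hs.trans_le hM
  have hN0 : (0 : ℝ) < N := by exact_mod_cast hN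
  have hm0 : (1 : ℝ) ≤ m := by exact_mod_cast hm
  have hmγ : m * γ ≤ 1 := by
    rw [le_div_iff₀ (by linarith)] at hγ
    linarith
  have h1 := Real.log_lt_log (by positivity) h
  rw [Real.log_mul (by positivity) (by positivity), Real.log_rpow hN0, Real.log_rpow hs] at h1
  have h2 := Real.log_le_log hs hM
  rw [← Real.log_le_log_iff hs (by positivity), Real.log_mul (by positivity) (by positivity),
    Real.log_rpow hN0, Real.log_pow]
  set X := Real.log (mixNorm n)
  set Y := Real.log (supNorm n)
  set Z := Real.log N
  have h3 : 0 ≤ (1 - m * γ) * (X - Y) := mul_nonneg (by linarith) (by linarith)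
  have h4 : 0 ≤ (m - 1) * (X - γ * Y - (1 - γ) * Z) := mul_nonneg (by linarith) (by linarith)
  refine le_of_mul_le_mul_left ?_ (by linarith : 0 < 1 - γ)
  linarith

/-! ### Sums over multi-indices -/

theorem tsum_shift {d : ℕ} (F : (Fin d → ℕ) → ENNReal) (k : Fin d → ℕ)
    [∀ n : Fin d → ℕ, Decidable (k ≤ n)] :
    ∑' n, (if k ≤ n then F (n - k) else 0) = ∑' n, F n := by
  have hinj : Function.Injective fun n : Fin d → ℕ => n + k := add_left_injective k
  rw [← hinj.tsum_eq]
  · refine tsum_congr fun n => ?_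
    rw [if_pos (le_add_of_nonneg_left (Pi.le_def.2 fun _ => Nat.zero_le _)), add_tsub_cancel_right]
  · intro n hn
    by_cases h : k ≤ n
    · exact ⟨n - k, tsub_add_cancel_of_le h⟩
    · simp [h] at hn

theorem single_le_iff {d : ℕ} (n : Fin d → ℕ) (j : Fin d) : Pi.single j 1 ≤ n ↔ 1 ≤ n j := by
  refine ⟨fun h => by simpa using h j, fun h i => ?_⟩
  by_cases hi : i = j
  · subst hi; simpa using h
  · simp [hi]

section Estimates

variable {d : ℕ} {α : Fin d → ℝ} (hα : ∀ j, 0 < α j) (β : Fin d → ℝ)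

/-- Parseval in `ENNReal`, so that weighted sums can be shifted and compared without summability
conditions. -/
theorem tsum_ofReal_sq_inner_hermiteBasis (u : L2 d) :
    ∑' n, ENNReal.ofReal (inner ℝ (hermiteBasis hα β n) u ^ 2) = ENNReal.ofReal (‖u‖ ^ 2) := by
  have h := hasSum_sq_inner_hermiteBasis hα β u
  rw [← h.tsum_eq, ENNReal.ofReal_tsum_of_nonneg (fun n => sq_nonneg _) h.summable]

/-! ### Hermite coefficients in the weighted Korobov space -/

/-- The test function in the weak definition may be a Hermite function, on which the formal adjoint
of `𝒟_{x_j}` is the raising operator. -/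
theorem inner_hermiteBasis_of_isHermiteDeriv {j : Fin d} {u w : L2 d}
    (h : IsHermiteDeriv α β j u w) (n : Fin d → ℕ) :
    inner ℝ (hermiteBasis hα β n) w
      = α j * Real.sqrt (2 * (n j + 1)) * inner ℝ (hermiteBasis hα β (n + Pi.single j 1)) u := by
  rw [inner_hermiteBasis, inner_hermiteBasis, h, ← integral_const_mul]
  refine integral_congr_ae (Filter.Eventually.of_forall fun x => ?_)
  simp only [hermiteSchwartz_raise]
  ring

/-- The square of the ratio between the Hermite coefficient of index `n` of `𝒟^k u` and the one of
index `n + k` of `u`. -/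
def korobovWeight (α : Fin d → ℝ) (k n : Fin d → ℕ) : ℝ :=
  ∏ j, (2 * α j ^ 2) ^ k j * ((n j + 1).ascFactorial (k j) : ℝ)

theorem korobovWeight_add_single (α : Fin d → ℝ) (k n : Fin d → ℕ) (j : Fin d) :
    korobovWeight α (k + Pi.single j 1) n
      = 2 * α j ^ 2 * (n j + 1) * korobovWeight α k (n + Pi.single j 1) := by
  rw [korobovWeight, korobovWeight, ← Finset.mul_prod_erase _ _ (Finset.mem_univ j),
    ← Finset.mul_prod_erase _ _ (Finset.mem_univ j), ← mul_assoc]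
  congr 1
  · have h := Nat.succ_ascFactorial (n j + 1) (k j)
    have h2 := Nat.ascFactorial_succ (n := n j + 1) (k := k j)
    simp only [Pi.add_apply, Pi.single_eq_same]
    have h3 : ((n j + 1).ascFactorial (k j + 1) : ℝ)
        = (n j + 1) * ((n j + 1 + 1).ascFactorial (k j) : ℝ) := by
      rw [h2, ← h]
      push_cast
      ring
    rw [h3, pow_succ]
    ring
  · refine Finset.prod_congr rfl fun i hi => ?_
    simp [Finset.ne_of_mem_erase hi]

theorem sq_inner_hermiteBasis_korobov {m : ℕ} (w : Korobov α β m) (k : Fin d → ℕ)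
    (hk : ∀ j, k j < m + 1) (n : Fin d → ℕ) :
    inner ℝ (hermiteBasis hα β n)
        ((w : PiLp 2 (fun _ : Fin d → Fin (m + 1) => L2 d)) fun j => ⟨k j, hk j⟩) ^ 2
      = korobovWeight α k n * inner ℝ (hermiteBasis hα β (n + k)) w.toL2 ^ 2 := by
  induction k using multiIndex_induction generalizing n with
  | h0 =>
    have : (fun j => ⟨(0 : Fin d → ℕ) j, hk j⟩ : Fin d → Fin (m + 1)) = 0 := rfl
    rw [this, add_zero]
    simp [korobovWeight, Korobov.toL2]
  | hs k j ih =>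
    have hk' : ∀ i, k i < m + 1 := fun i => lt_of_le_of_lt (by simp) (hk i)
    have hw := w.2 (fun i => ⟨k i, hk' i⟩) (fun i => ⟨(k + Pi.single j 1 : Fin d → ℕ) i, hk i⟩) j
      (by simp) (fun i hi => by ext; simp [hi])
    rw [inner_hermiteBasis_of_isHermiteDeriv hα β hw, mul_pow, ih hk', mul_pow,
      Real.sq_sqrt (by positivity), korobovWeight_add_single, add_assoc n,
      add_comm (Pi.single j 1) k]
    ring

theorem pow_max_le_ascFactorial {m p : ℕ} (hm : 1 ≤ m) (hp : m ≤ p) :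
    (max 1 p) ^ m ≤ m ^ m * (p - m + 1).ascFactorial m := by
  have h1 : max 1 p = p := max_eq_right (hm.trans hp)
  have h2 : p ≤ m * (p - m + 1) := by
    obtain ⟨q, rfl⟩ := Nat.exists_eq_add_of_le hp
    rw [Nat.add_sub_cancel_left]
    nlinarith
  calc (max 1 p) ^ m ≤ (m * (p - m + 1)) ^ m := by rw [h1]; gcongr
    _ = m ^ m * (p - m + 1) ^ m := mul_pow _ _ _
    _ ≤ _ := by gcongr; exact Nat.pow_succ_le_ascFactorial _ _

/-- No single `k` works for all `n`: differentiating `m` times in a direction with `n_j < m`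
annihilates the mode. So `k_j = m` is taken where `n_j ≥ m`, and `k_j = 0` elsewhere, where `max(1,
n_j)^m ≤ m^m` is a constant anyway. -/
theorem exists_mixNorm_pow_le_korobovWeight (α : Fin d → ℝ) (hα : ∀ j, 0 < α j) {m : ℕ}
    (hm : 1 ≤ m) : ∃ K : ℝ, 0 < K ∧ ∀ n : Fin d → ℕ, ∃ k : Fin d → ℕ,
      (∀ j, k j < m + 1) ∧ k ≤ n ∧ (mixNorm n : ℝ) ^ m ≤ K * korobovWeight α k (n - k) := by
  have hpos : ∀ j, 0 < (m : ℝ) ^ m * (1 + ((2 * α j ^ 2) ^ m)⁻¹) := by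
    intro j
    have := hα j
    have : (0 : ℝ) < m := by exact_mod_cast hm
    positivity
  -- Each factor serves both choices of `k_j`: `m^m` bounds the low modes, and the inverse power
  -- cancels `(2 α_j²)^m` in the weight of the high ones.
  refine ⟨∏ j, (m : ℝ) ^ m * (1 + ((2 * α j ^ 2) ^ m)⁻¹), Finset.prod_pos fun j _ => hpos j,
    fun n => ⟨fun j => if m ≤ n j then m else 0, ?_, ?_, ?_⟩⟩
  · intro j
    dsimp only
    split_ifs <;> omega
  · intro j
    dsimp only
    split_ifs with h
    · exact h
    · exact Nat.zero_le _
  · rw [korobovWeight, ← Finset.prod_mul_distrib, mixNorm, Nat.cast_prod, ← Finset.prod_pow]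
    refine Finset.prod_le_prod (fun j _ => by positivity) fun j _ => ?_
    have h2 : (0 : ℝ) < (2 * α j ^ 2) ^ m := by have := hα j; positivity
    simp only [Pi.sub_apply]
    split_ifs with h
    · have h1 : ((max 1 (n j) : ℕ) : ℝ) ^ m ≤ (m : ℝ) ^ m * ((n j - m + 1).ascFactorial m : ℝ) := by
        exact_mod_cast pow_max_le_ascFactorial hm h
      refine h1.trans ?_
      have h3 : (1 : ℝ) ≤ (1 + ((2 * α j ^ 2) ^ m)⁻¹) * (2 * α j ^ 2) ^ m := by
        rw [add_mul, inv_mul_cancel₀ h2.ne']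
        linarith
      calc (m : ℝ) ^ m * ((n j - m + 1).ascFactorial m : ℝ)
          ≤ ((1 + ((2 * α j ^ 2) ^ m)⁻¹) * (2 * α j ^ 2) ^ m) *
            ((m : ℝ) ^ m * ((n j - m + 1).ascFactorial m : ℝ)) :=
            le_mul_of_one_le_left (by positivity) h3
        _ = _ := by ring
    · have h1 : ((max 1 (n j) : ℕ) : ℝ) ^ m ≤ (m : ℝ) ^ m := by
        gcongr
        exact max_le hm (by omega)
      have h4 : (m : ℝ) ^ m ≤ (m : ℝ) ^ m * (1 + ((2 * α j ^ 2) ^ m)⁻¹) :=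
        le_mul_of_one_le_right (by positivity) (by linarith [inv_pos.2 h2])
      simpa using h1.trans h4

theorem norm_sq_korobov {m : ℕ} (w : Korobov α β m) : ‖w‖ ^ 2 =
    ∑ k, ‖(w : PiLp 2 (fun _ : Fin d → Fin (m + 1) => L2 d)) k‖ ^ 2 := by
  rw [Submodule.coe_norm, PiLp.norm_sq_eq_of_L2]

theorem exists_tsum_mixNorm_pow_le (α : Fin d → ℝ) (hα : ∀ j, 0 < α j) {m : ℕ} (hm : 1 ≤ m) :
    ∃ K : ℝ, 0 < K ∧ ∀ (β : Fin d → ℝ) (w : Korobov α β m),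
      ∑' n, ENNReal.ofReal ((mixNorm n : ℝ) ^ m * inner ℝ (hermiteBasis hα β n) w.toL2 ^ 2)
        ≤ ENNReal.ofReal (K * ‖w‖ ^ 2) := by
  classical
  obtain ⟨K, hK, h⟩ := exists_mixNorm_pow_le_korobovWeight α hα hm
  refine ⟨K, hK, fun β w => ?_⟩
  set v : PiLp 2 (fun _ : Fin d → Fin (m + 1) => L2 d) := w.1
  set F : (Fin d → Fin (m + 1)) → (Fin d → ℕ) → ENNReal :=
    fun k n => ENNReal.ofReal (K * inner ℝ (hermiteBasis hα β n) (v k) ^ 2) with hF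
  have hFsum : ∀ k, ∑' n, F k n = ENNReal.ofReal (K * ‖v k‖ ^ 2) := by
    intro k
    simp only [hF, ENNReal.ofReal_mul hK.le]
    rw [ENNReal.tsum_mul_left, tsum_ofReal_sq_inner_hermiteBasis]
  calc ∑' n, ENNReal.ofReal ((mixNorm n : ℝ) ^ m * inner ℝ (hermiteBasis hα β n) w.toL2 ^ 2)
      ≤ ∑' n, ∑ k : Fin d → Fin (m + 1), (if (fun j => (k j : ℕ)) ≤ n then
          F k (n - fun j => (k j : ℕ)) else 0) := by
        refine ENNReal.tsum_le_tsum fun n => ?_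
        obtain ⟨k, hkm, hkn, hle⟩ := h n
        -- The suitable `k` depends on `n`; summing over all `k` removes this dependence, and each
        -- `k` then contributes a shifted Parseval sum.
        refine le_trans ?_ (Finset.single_le_sum (f := fun k : Fin d → Fin (m + 1) =>
          if (fun j => (k j : ℕ)) ≤ n then F k (n - fun j => (k j : ℕ)) else 0)
          (fun _ _ => bot_le) (Finset.mem_univ fun j => ⟨k j, hkm j⟩))
        dsimp only
        rw [if_pos hkn]
        refine ENNReal.ofReal_le_ofReal ?_
        rw [sq_inner_hermiteBasis_korobov hα β w k hkm, tsub_add_cancel_of_le hkn, ← mul_assoc]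
        gcongr
    _ = ∑ k : Fin d → Fin (m + 1), ENNReal.ofReal (K * ‖v k‖ ^ 2) := by
        rw [Summable.tsum_finsetSum fun _ _ => ENNReal.summable]
        refine Finset.sum_congr rfl fun k _ => ?_
        rw [tsum_shift, hFsum]
    _ = ENNReal.ofReal (K * ‖w‖ ^ 2) := by
        rw [norm_sq_korobov, Finset.mul_sum,
          ENNReal.ofReal_sum_of_nonneg fun _ _ => by positivity]

/-! ### Hermite expansions in `H¹(ℝᵈ)` -/

theorem norm_sq_H1 (V : H1 d) : ‖V‖ ^ 2 = ‖V.toL2‖ ^ 2 + ∑ j, ‖V.partial j‖ ^ 2 := by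
  rw [Submodule.coe_norm, WithLp.prod_norm_sq_eq_of_L2, PiLp.norm_sq_eq_of_L2]
  rfl

/-- The embedding of `H¹(ℝᵈ)` into `L²(ℝᵈ)` as a linear map. -/
def H1.toL2Linear (d : ℕ) : H1 d →ₗ[ℝ] L2 d where
  toFun := H1.toL2
  map_add' _ _ := rfl
  map_smul' _ _ := rfl

theorem H1.toL2Linear_apply (V : H1 d) : H1.toL2Linear d V = V.toL2 := rfl

/-- The Hermite functions as elements of `H¹(ℝᵈ)`. -/
def hermiteH1 (n : Fin d → ℕ) : H1 d :=
  ⟨WithLp.toLp 2 ((hermiteSchwartz hα β n).toLp 2, WithLp.toLp 2 fun j =>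
    (LineDeriv.lineDerivOp (Pi.single j (1 : ℝ) : Fin d → ℝ) (hermiteSchwartz hα β n)).toLp 2), by
    intro j φ
    have h1 : ∫ x, ((LineDeriv.lineDerivOp (Pi.single j (1 : ℝ) : Fin d → ℝ)
        (hermiteSchwartz hα β n)).toLp 2 : L2 d) x * φ x =
        ∫ x, fderiv ℝ (hermiteSchwartz hα β n) x (Pi.single j 1) * φ x := by
      refine integral_congr_ae ?_
      filter_upwards [(LineDeriv.lineDerivOp (Pi.single j (1 : ℝ) : Fin d → ℝ)
        (hermiteSchwartz hα β n)).coeFn_toLp 2] with x hx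
      rw [hx]
      rfl
    have h2 : ∫ x, ((hermiteSchwartz hα β n).toLp 2 : L2 d) x * fderiv ℝ φ x (Pi.single j 1) =
        ∫ x, hermiteSchwartz hα β n x * fderiv ℝ φ x (Pi.single j 1) := by
      refine integral_congr_ae ?_
      filter_upwards [(hermiteSchwartz hα β n).coeFn_toLp 2] with x hx
      rw [hx]
    refine h1.trans ?_
    rw [← neg_eq_iff_eq_neg.2 (integral_mul_fderiv_eq_neg j (hermiteSchwartz hα β n) φ), ← h2]
    rfl⟩

theorem toL2_hermiteH1 (n : Fin d → ℕ) : (hermiteH1 hα β n).toL2 = hermiteBasis hα β n := by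
  rw [hermiteBasis_apply]
  rfl

/-- Half the difference of the lowering and raising relations isolates `∂_j` on Hermite functions;
the definition of the weak derivative moves it there. -/
theorem inner_hermiteBasis_partial (V : H1 d) (n : Fin d → ℕ) (j : Fin d) :
    inner ℝ (hermiteBasis hα β n) (V.partial j) = α j / 2 *
      (Real.sqrt (2 * (n j + 1)) * inner ℝ (hermiteBasis hα β (n + Pi.single j 1)) V.toL2
        - Real.sqrt (2 * n j) * inner ℝ (hermiteBasis hα β (n - Pi.single j 1)) V.toL2) := by
  have h1 := (integrable_mul_schwartz V.toL2
    (hermiteSchwartz hα β (n + Pi.single j 1))).const_mul (Real.sqrt (2 * (n j + 1)))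
  have h2 := (integrable_mul_schwartz V.toL2
    (hermiteSchwartz hα β (n - Pi.single j 1))).const_mul (Real.sqrt (2 * n j))
  rw [inner_hermiteBasis, inner_hermiteBasis, inner_hermiteBasis, ← integral_const_mul,
    ← integral_const_mul, ← integral_sub h1 h2, ← integral_const_mul]
  refine (V.2 j (hermiteSchwartz hα β n)).trans ?_
  rw [← integral_neg]
  refine integral_congr_ae (Filter.Eventually.of_forall fun x => ?_)
  have h3 := hermiteSchwartz_raise hα β n j x
  have h4 := hermiteSchwartz_lower hα β n j x
  change -(V.toL2 x * _) = _
  simp only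
  linear_combination (V.toL2 x / 2) * (h3 - h4)

theorem sq_inner_hermiteBasis_partial_le (V : H1 d) (n : Fin d → ℕ) (j : Fin d) :
    inner ℝ (hermiteBasis hα β n) (V.partial j) ^ 2 ≤
      α j ^ 2 * (n j + 1) * inner ℝ (hermiteBasis hα β (n + Pi.single j 1)) V.toL2 ^ 2
        + α j ^ 2 * n j * inner ℝ (hermiteBasis hα β (n - Pi.single j 1)) V.toL2 ^ 2 := by
  rw [inner_hermiteBasis_partial]
  set a := inner ℝ (hermiteBasis hα β (n + Pi.single j 1)) V.toL2
  set b := inner ℝ (hermiteBasis hα β (n - Pi.single j 1)) V.toL2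
  have h1 : Real.sqrt (2 * ((n j : ℝ) + 1)) ^ 2 = 2 * (n j + 1) := Real.sq_sqrt (by positivity)
  have h2 : Real.sqrt (2 * (n j : ℝ)) ^ 2 = 2 * n j := Real.sq_sqrt (by positivity)
  have h3 : 0 ≤ (α j / 2) ^ 2 *
      (Real.sqrt (2 * ((n j : ℝ) + 1)) * a + Real.sqrt (2 * (n j : ℝ)) * b) ^ 2 := by positivity
  linear_combination h3 + α j ^ 2 / 2 * a ^ 2 * h1 + α j ^ 2 / 2 * b ^ 2 * h2

theorem ofReal_norm_sq_partial_le (V : H1 d) (j : Fin d) :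
    ENNReal.ofReal (‖V.partial j‖ ^ 2) ≤
      ∑' n, ENNReal.ofReal (α j ^ 2 * (2 * n j + 1) *
        inner ℝ (hermiteBasis hα β n) V.toL2 ^ 2) := by
  classical
  set a : (Fin d → ℕ) → ℝ := fun n => inner ℝ (hermiteBasis hα β n) V.toL2
  set G₁ : (Fin d → ℕ) → ENNReal := fun n => ENNReal.ofReal (α j ^ 2 * n j * a n ^ 2) with hG₁
  set G₂ : (Fin d → ℕ) → ENNReal := fun n => ENNReal.ofReal (α j ^ 2 * (n j + 1) * a n ^ 2) with hG₂
  rw [← tsum_ofReal_sq_inner_hermiteBasis hα β]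
  calc ∑' n, ENNReal.ofReal (inner ℝ (hermiteBasis hα β n) (V.partial j) ^ 2)
      ≤ ∑' n, (G₁ (n + Pi.single j 1) +
          if Pi.single j 1 ≤ n then G₂ (n - Pi.single j 1) else 0) := by
        refine ENNReal.tsum_le_tsum fun n => ?_
        refine (ENNReal.ofReal_le_ofReal (sq_inner_hermiteBasis_partial_le hα β V n j)).trans ?_
        refine ENNReal.ofReal_add_le.trans (add_le_add (le_of_eq ?_) ?_)
        · simp [hG₁, a]
        · split_ifs with h
          · refine le_of_eq ?_
            simp only [hG₂, a, Pi.sub_apply, Pi.single_eq_same]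
            rw [Nat.cast_sub ((single_le_iff n j).1 h)]
            simp
          -- When `n_j = 0` the lowered index is truncated, but its coefficient `α_j² n_j` is zero.
          · rw [single_le_iff] at h
            simp [show n j = 0 by omega]
    _ ≤ ∑' n, G₁ n + ∑' n, G₂ n := by
        rw [ENNReal.tsum_add, tsum_shift]
        exact add_le_add (ENNReal.tsum_comp_le_tsum_of_injective
          (add_left_injective (Pi.single j 1)) G₁) le_rfl
    _ = _ := by
        rw [← ENNReal.tsum_add]
        refine tsum_congr fun n => ?_
        rw [hG₁, hG₂, ← ENNReal.ofReal_add (by positivity) (by positivity)]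
        congr 1
        ring

theorem ofReal_norm_sq_H1_le (V : H1 d) :
    ENNReal.ofReal (‖V‖ ^ 2) ≤
      ∑' n, ENNReal.ofReal ((1 + ∑ j, α j ^ 2 * (2 * n j + 1)) *
        inner ℝ (hermiteBasis hα β n) V.toL2 ^ 2) := by
  rw [norm_sq_H1, ENNReal.ofReal_add (by positivity) (by positivity),
    ENNReal.ofReal_sum_of_nonneg fun _ _ => by positivity,
    ← tsum_ofReal_sq_inner_hermiteBasis hα β]
  refine (add_le_add le_rfl
    (Finset.sum_le_sum fun j _ => ofReal_norm_sq_partial_le hα β V j)).trans (le_of_eq ?_)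
  rw [← Summable.tsum_finsetSum fun _ _ => ENNReal.summable, ← ENNReal.tsum_add]
  refine tsum_congr fun n => ?_
  rw [← ENNReal.ofReal_sum_of_nonneg fun _ _ => by positivity,
    ← ENNReal.ofReal_add (by positivity) (by positivity), add_mul, one_mul, Finset.sum_mul]

/-- The partial sum of the Hermite expansion of `u` over a finite set of indices, in `H¹(ℝᵈ)`. -/
def hermiteProj (F : Finset (Fin d → ℕ)) (u : L2 d) : H1 d :=
  ∑ n ∈ F, inner ℝ (hermiteBasis hα β n) u • hermiteH1 hα β n

theorem toL2_hermiteProj (F : Finset (Fin d → ℕ)) (u : L2 d) :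
    (hermiteProj hα β F u).toL2
      = ∑ n ∈ F, inner ℝ (hermiteBasis hα β n) u • hermiteBasis hα β n := by
  rw [← H1.toL2Linear_apply, hermiteProj, map_sum]
  refine Finset.sum_congr rfl fun n _ => ?_
  rw [map_smul, H1.toL2Linear_apply, toL2_hermiteH1]

theorem inner_hermiteBasis_hermiteProj (F : Finset (Fin d → ℕ)) (u : L2 d) (n : Fin d → ℕ) :
    inner ℝ (hermiteBasis hα β n) (hermiteProj hα β F u).toL2
      = if n ∈ F then inner ℝ (hermiteBasis hα β n) u else 0 := by
  classical
  have h := (orthonormal_iff_ite.1 (hermiteBasis hα β).orthonormal)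
  rw [toL2_hermiteProj, inner_sum]
  simp only [inner_smul_right, h]
  simp

theorem exists_norm_sub_hermiteProj_sq_le (α : Fin d → ℝ) (hα : ∀ j, 0 < α j) {m : ℕ}
    (hm : 1 < m) {γ : ℝ} (hγ : γ ≤ 1 / (m : ℝ)) (hγ1 : γ < 1) :
    ∃ K : ℝ, 0 < K ∧ ∀ (β : Fin d → ℝ) (w : Korobov α β m) (V : H1 d), V.toL2 = w.toL2 →
      ∀ (N : ℕ), 1 ≤ N → ∀ F : Finset (Fin d → ℕ), (F : Set (Fin d → ℕ)) = hyperbolicCross d N γ →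
        ‖V - hermiteProj hα β F V.toL2‖ ^ 2 ≤ K * (N : ℝ) ^ (1 - (m : ℝ)) * ‖w‖ ^ 2 := by
  obtain ⟨K, hK, h⟩ := exists_tsum_mixNorm_pow_le α hα hm.le
  -- Since `|n|_∞ ≥ 1` outside the cross, `2 n_j + 1 ≤ 3 |n|_∞`, so the `H¹` weight is at most `M
  -- |n|_∞`.
  set M : ℝ := 1 + ∑ j, α j ^ 2 * 3 with hM
  have hM0 : 0 < M := by positivity
  refine ⟨M * K, by positivity, fun β w V hV N hN F hF => ?_⟩
  have hN0 : (0 : ℝ) < N := by exact_mod_cast hN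
  refine (ENNReal.ofReal_le_ofReal_iff (by positivity)).1 ?_
  refine (ofReal_norm_sq_H1_le hα β _).trans ?_
  have hcoef : ∀ n, inner ℝ (hermiteBasis hα β n) (V - hermiteProj hα β F V.toL2).toL2
      = if n ∈ F then 0 else inner ℝ (hermiteBasis hα β n) w.toL2 := by
    intro n
    rw [← H1.toL2Linear_apply, map_sub, H1.toL2Linear_apply, H1.toL2Linear_apply, inner_sub_right,
      inner_hermiteBasis_hermiteProj, hV]
    split_ifs <;> simp
  calc ∑' n : Fin d → ℕ, ENNReal.ofReal ((1 + ∑ j, α j ^ 2 * (2 * n j + 1)) *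
        inner ℝ (hermiteBasis hα β n) (V - hermiteProj hα β F V.toL2).toL2 ^ 2)
      ≤ ∑' n, ENNReal.ofReal (M * (N : ℝ) ^ (1 - (m : ℝ))) * ENNReal.ofReal
          ((mixNorm n : ℝ) ^ m * inner ℝ (hermiteBasis hα β n) w.toL2 ^ 2) := by
        refine ENNReal.tsum_le_tsum fun n => ?_
        rw [← ENNReal.ofReal_mul (by positivity), hcoef]
        refine ENNReal.ofReal_le_ofReal ?_
        split_ifs with hn
        · rw [sq, mul_zero, mul_zero]
          positivity
        · have hn' : n ∉ hyperbolicCross d N γ := by rwa [← hF, Finset.mem_coe]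
          have hs := supNorm_le_of_notMem_hyperbolicCross hm.le hγ hγ1 hN hn'
          have hs1 : (1 : ℝ) ≤ supNorm n := by
            exact_mod_cast supNorm_pos fun h0 => hn' (Or.inl h0)
          have h1 : 1 + ∑ j, α j ^ 2 * (2 * (n j : ℝ) + 1) ≤ M * supNorm n := by
            rw [hM, add_mul, one_mul, Finset.sum_mul]
            refine add_le_add hs1 (Finset.sum_le_sum fun j _ => ?_)
            have h2 : (n j : ℝ) ≤ supNorm n := by exact_mod_cast le_supNorm n j
            rw [mul_assoc]
            gcongr
            linarith
          rw [← mul_assoc, mul_assoc M]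
          gcongr
          exact h1.trans (by gcongr)
    _ ≤ ENNReal.ofReal (M * (N : ℝ) ^ (1 - (m : ℝ))) * ENNReal.ofReal (K * ‖w‖ ^ 2) := by
        rw [ENNReal.tsum_mul_left]
        gcongr
        exact h β w
    _ = _ := by
        rw [← ENNReal.ofReal_mul (by positivity)]
        congr 1
        ring

end Estimates

/-! ### The bilinear form -/

theorem Coefficients.form_add_left {d : ℕ} {P : Coefficients d} {C : ℝ} (hP : P.IsContinuous C)
    (U U' V : H1 d) : P.form (U + U') V = P.form U V + P.form U' V := by
  rw [form, form, form, ← integral_add (hP U V).1 (hP U' V).1]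
  refine integral_congr_ae ?_
  filter_upwards [Lp.coeFn_add U.toL2 U'.toL2,
    ae_all_iff.2 fun j => Lp.coeFn_add (U.partial j) (U'.partial j)] with x h1 h2
  have h3 : (U + U').toL2 x = U.toL2 x + U'.toL2 x := h1
  have h4 : ∀ j, (U + U').partial j x = U.partial j x + U'.partial j x := h2
  simp only [integrand, h3, h4, mul_add, add_mul, Finset.sum_add_distrib]
  ring

theorem Coefficients.form_add_right {d : ℕ} {P : Coefficients d} {C : ℝ} (hP : P.IsContinuous C)
    (U V V' : H1 d) : P.form U (V + V') = P.form U V + P.form U V' := by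
  rw [form, form, form, ← integral_add (hP U V).1 (hP U V').1]
  refine integral_congr_ae ?_
  filter_upwards [Lp.coeFn_add V.toL2 V'.toL2,
    ae_all_iff.2 fun j => Lp.coeFn_add (V.partial j) (V'.partial j)] with x h1 h2
  have h3 : (V + V').toL2 x = V.toL2 x + V'.toL2 x := h1
  have h4 : ∀ j, (V + V').partial j x = V.partial j x + V'.partial j x := h2
  simp only [integrand, h3, h4, mul_add, add_mul, Finset.sum_add_distrib]
  ring

theorem Coefficients.form_smul_left {d : ℕ} (P : Coefficients d) (r : ℝ) (U V : H1 d) :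
    P.form (r • U) V = r * P.form U V := by
  rw [form, form, ← integral_const_mul]
  refine integral_congr_ae ?_
  filter_upwards [Lp.coeFn_smul r U.toL2,
    ae_all_iff.2 fun j => Lp.coeFn_smul r (U.partial j)] with x h1 h2
  have h3 : (r • U).toL2 x = r * U.toL2 x := h1
  have h4 : ∀ j, (r • U).partial j x = r * U.partial j x := h2
  simp only [integrand, h3, h4, mul_left_comm _ r, mul_assoc r, ← Finset.mul_sum, ← mul_add]

theorem Coefficients.form_smul_right {d : ℕ} (P : Coefficients d) (r : ℝ) (U V : H1 d) :
    P.form U (r • V) = r * P.form U V := by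
  rw [form, form, ← integral_const_mul]
  refine integral_congr_ae ?_
  filter_upwards [Lp.coeFn_smul r V.toL2,
    ae_all_iff.2 fun j => Lp.coeFn_smul r (V.partial j)] with x h1 h2
  have h3 : (r • V).toL2 x = r * V.toL2 x := h1
  have h4 : ∀ j, (r • V).partial j x = r * V.partial j x := h2
  simp only [integrand, h3, h4, mul_left_comm _ r, mul_assoc r, ← Finset.mul_sum, ← mul_add]

/-- The bilinear form as a continuous bilinear map. -/
def Coefficients.formCLM {d : ℕ} (P : Coefficients d) {C : ℝ} (hP : P.IsContinuous C) :
    H1 d →L[ℝ] H1 d →L[ℝ] ℝ :=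
  LinearMap.mkContinuous₂
    (LinearMap.mk₂ ℝ P.form (form_add_left hP) P.form_smul_left (form_add_right hP)
      P.form_smul_right) C fun U V => (hP U V).2

theorem Coefficients.formCLM_apply {d : ℕ} (P : Coefficients d) {C : ℝ} (hP : P.IsContinuous C)
    (U V : H1 d) : P.formCLM hP U V = P.form U V := rfl

/-- The form tested with the error is controlled by the approximation error alone. -/
theorem Coefficients.form_sub_le {d : ℕ} {P : Coefficients d} {C κ : ℝ} (hP : P.IsContinuous C)
    (hcoer : P.IsCoercive κ) (hκ : 0 < κ) (R E : H1 d) :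
    P.form (R - E) E ≤ C ^ 2 / (4 * κ) * ‖R‖ ^ 2 := by
  have h1 : P.form (R - E) E = P.form R E - P.form E E := by
    rw [← formCLM_apply P hP, map_sub]
    rfl
  have h2 := (le_abs_self _).trans (hP R E).2
  have h3 := hcoer E
  -- Young's inequality by completing the square, so that coercivity absorbs all of `‖E‖²`.
  have h4 : C ^ 2 / (4 * κ) * ‖R‖ ^ 2 - (C * ‖R‖ * ‖E‖ - κ * ‖E‖ ^ 2)
      = (C * ‖R‖ - 2 * κ * ‖E‖) ^ 2 / (4 * κ) := by
    field_simp
    ring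
  have h5 : 0 ≤ (C * ‖R‖ - 2 * κ * ‖E‖) ^ 2 / (4 * κ) := by positivity
  linarith

/-! ### Real-variable lemmas -/

/-- The product rule for the primitive, which is absolutely continuous, integrated from its zero at
`0`. It gives the energy identity one coefficient at a time. -/
theorem sq_intervalIntegral_eq {g : ℝ → ℝ} {t : ℝ} (hg : IntervalIntegrable g volume 0 t) :
    (∫ s in (0 : ℝ)..t, g s) ^ 2 = 2 * ∫ s in (0 : ℝ)..t, (∫ r in (0 : ℝ)..s, g r) * g s := by
  have hac := hg.absolutelyContinuousOnInterval_intervalIntegral (c := 0) (by simp)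
  have h := hac.integral_deriv_mul_eq_sub hac
  simp only [intervalIntegral.integral_same, mul_zero, sub_zero] at h
  rw [sq, ← h, ← intervalIntegral.integral_const_mul]
  refine intervalIntegral.integral_congr_ae ?_
  filter_upwards [hg.ae_hasDerivAt_integral] with s hs hst
  rw [(hs (uIoc_subset_uIcc hst) 0 (by simp)).deriv]
  ring

theorem le_of_ae_le_of_continuousOn {h : ℝ → ℝ} {T B : ℝ} (hT : 0 < T)
    (hc : ContinuousOn h (Icc 0 T)) (hae : ∀ᵐ s ∂(volume.restrict (Ioc 0 T)), h s ≤ B) :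
    ∀ t ∈ Icc 0 T, h t ≤ B := by
  rw [Measure.restrict_congr_set Ioc_ae_eq_Icc] at hae
  have h1 : (fun s => max (h s) B) =ᵐ[volume.restrict (Icc 0 T)] fun _ => B := by
    filter_upwards [hae] with s hs using max_eq_right hs
  intro t ht
  exact max_eq_right_iff.1 (Measure.eqOn_Icc_of_ae_eq volume hT.ne h1
    (hc.sup continuousOn_const) continuousOn_const ht)

theorem integral_norm_sq_eq_eLpNorm {X E : Type*} [MeasurableSpace X] {μ : Measure X}
    [NormedAddCommGroup E] {f : X → E} (hf : MemLp f 2 μ) :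
    ∫ x, ‖f x‖ ^ 2 ∂μ = (eLpNorm f 2 μ).toReal ^ 2 := by
  have h := hf.eLpNorm_eq_integral_rpow_norm (by norm_num) (by norm_num)
  have h0 : 0 ≤ ∫ x, ‖f x‖ ^ 2 ∂μ := integral_nonneg fun x => by positivity
  simp only [ENNReal.toReal_ofNat, Real.rpow_ofNat] at h
  rw [h, ENNReal.toReal_ofReal (by positivity), ← Real.rpow_natCast, ← Real.rpow_mul h0]
  norm_num

theorem ae_norm_le_eLpNorm_top {X E : Type*} [MeasurableSpace X] {μ : Measure X}
    [NormedAddCommGroup E] {f : X → E} (hf : MemLp f ⊤ μ) :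
    ∀ᵐ x ∂μ, ‖f x‖ ≤ (eLpNorm f ⊤ μ).toReal := by
  rw [eLpNorm_exponent_top]
  have h : eLpNormEssSup f μ ≠ ⊤ := by
    rw [← eLpNorm_exponent_top]
    exact hf.eLpNorm_ne_top
  filter_upwards [ae_le_eLpNormEssSup (f := f) (μ := μ)] with x hx
  rw [← toReal_enorm]
  exact ENNReal.toReal_mono h hx

section Galerkin

variable {d : ℕ} {α : Fin d → ℝ} (hα : ∀ j, 0 < α j) (β : Fin d → ℝ)

/-! ### The approximation spaces -/

theorem hermiteBasis_ae_eq (n : Fin d → ℕ) : hermiteBasis hα β n =ᵐ[volume] hermiteTensor α β n := by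
  rw [hermiteBasis_apply]
  filter_upwards [(hermiteSchwartz hα β n).coeFn_toLp 2] with x hx
  rw [hx, hermiteSchwartz_apply]

theorem hermiteBasis_mem_approxSpace {Ω : Set (Fin d → ℕ)} {n : Fin d → ℕ} (hn : n ∈ Ω) :
    hermiteBasis hα β n ∈ approxSpace α β Ω :=
  Submodule.subset_span ⟨n, hn, hermiteBasis_ae_eq hα β n⟩

theorem eq_sum_of_mem_approxSpace {F : Finset (Fin d → ℕ)} {x : L2 d}
    (hx : x ∈ approxSpace α β (F : Set (Fin d → ℕ))) :
    x = ∑ n ∈ F, inner ℝ (hermiteBasis hα β n) x • hermiteBasis hα β n := by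
  classical
  refine Submodule.span_induction ?_ ?_ ?_ ?_ hx
  · rintro h ⟨n, hn, hh⟩
    have h1 : h = hermiteBasis hα β n := Lp.ext (hh.trans (hermiteBasis_ae_eq hα β n).symm)
    have ho := orthonormal_iff_ite.1 (hermiteBasis hα β).orthonormal
    rw [h1]
    simp only [ho, ite_smul, one_smul, zero_smul]
    rw [Finset.sum_ite_eq' F n, if_pos (Finset.mem_coe.1 hn)]
  · simp
  · intro x y _ _ hx hy
    simp only [inner_add_right, add_smul, Finset.sum_add_distrib]
    rw [← hx, ← hy]
  · intro c x _ hx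
    simp only [inner_smul_right, mul_smul, ← Finset.smul_sum]
    rw [← hx]

theorem hermiteProj_sub (F : Finset (Fin d → ℕ)) (u v : L2 d) :
    hermiteProj hα β F (u - v) = hermiteProj hα β F u - hermiteProj hα β F v := by
  simp only [hermiteProj, inner_sub_right, sub_smul, Finset.sum_sub_distrib]

/-- The `H¹` norm is bounded by a weighted sum of Hermite coefficients of the function alone, so a
zero function has zero weak gradient. Any scaling will do; `α = 1`, `β = 0` is chosen. -/
theorem H1.eq_of_toL2_eq {U V : H1 d} (h : U.toL2 = V.toL2) : U = V := by
  have h0 : (U - V).toL2 = 0 := by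
    rw [← H1.toL2Linear_apply, map_sub, H1.toL2Linear_apply, H1.toL2Linear_apply, h, sub_self]
  have h1 := ofReal_norm_sq_H1_le (α := fun _ => 1) (fun _ => one_pos) 0 (U - V)
  simp only [h0, inner_zero_right] at h1
  rw [← sub_eq_zero, ← norm_eq_zero, ← sq_eq_zero_iff]
  exact le_antisymm (by simpa using h1) (sq_nonneg _)

theorem hermiteProj_eq_self {F : Finset (Fin d → ℕ)} {U : H1 d}
    (hU : U.toL2 ∈ approxSpace α β (F : Set (Fin d → ℕ))) : hermiteProj hα β F U.toL2 = U := by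
  refine H1.eq_of_toL2_eq ?_
  rw [toL2_hermiteProj]
  exact (eq_sum_of_mem_approxSpace hα β hU).symm

theorem norm_sq_toL2_hermiteProj (F : Finset (Fin d → ℕ)) (u : L2 d) :
    ‖(hermiteProj hα β F u).toL2‖ ^ 2 = ∑ n ∈ F, inner ℝ (hermiteBasis hα β n) u ^ 2 := by
  rw [toL2_hermiteProj, ← real_inner_self_eq_norm_sq,
    (hermiteBasis hα β).orthonormal.inner_sum]
  simp [sq]

theorem norm_toL2_le (V : H1 d) : ‖V.toL2‖ ≤ ‖V‖ := by
  refine abs_le_of_sq_le_sq' ?_ (norm_nonneg _) |>.2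
  rw [norm_sq_H1]
  exact le_add_of_nonneg_right (Finset.sum_nonneg fun _ _ => by positivity)

/-! ### The error estimate -/

theorem intervalIntegrable_form_left {P : Coefficients d} {C : ℝ} (hP : P.IsContinuous C)
    {V : ℝ → H1 d} {a b : ℝ} (hV : IntervalIntegrable V volume a b) (φ : H1 d) :
    IntervalIntegrable (fun s => P.form (V s) φ) volume a b :=
  ⟨((P.formCLM hP).flip φ).integrable_comp hV.1, ((P.formCLM hP).flip φ).integrable_comp hV.2⟩

/-- The energy estimate for the distance from the Galerkin approximation to the projection of the
solution. -/
theorem norm_sq_galerkin_sub_hermiteProj_le {P : Coefficients d} {C κ : ℝ}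
    (hP : P.IsContinuous C) (hcoer : P.IsCoercive κ) (hκ : 0 < κ) {T : ℝ} {f : ℝ → L2 d}
    {u₀ : L2 d} {u : ℝ → L2 d} {V : ℝ → H1 d} (hV : MemLp V 2 (volume.restrict (Ioc 0 T)))
    (hVu : ∀ᵐ s ∂(volume.restrict (Ioc 0 T)), (V s).toL2 = u s)
    (hsol : ∀ φ : H1 d, ∀ t ∈ Icc 0 T,
      inner ℝ (u t) φ.toL2 + (∫ s in (0 : ℝ)..t, P.form (V s) φ)
        = inner ℝ u₀ φ.toL2 + ∫ s in (0 : ℝ)..t, inner ℝ (f s) φ.toL2)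
    {F : Finset (Fin d → ℕ)} {uN : ℝ → H1 d}
    (huN : IsGalerkinSolution P T f u₀ (approxSpace α β (F : Set (Fin d → ℕ))) uN)
    {ρ : ℝ → ℝ} (hρ : IntegrableOn ρ (Ioc 0 T)) (hρ0 : ∀ s, 0 ≤ ρ s)
    (hVρ : ∀ᵐ s ∂(volume.restrict (Ioc 0 T)),
      ‖V s - hermiteProj hα β F (V s).toL2‖ ^ 2 ≤ ρ s) {t : ℝ} (ht : t ∈ Icc 0 T) :
    ‖(hermiteProj hα β F (u t)).toL2 - (uN t).toL2‖ ^ 2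
      ≤ C ^ 2 / (2 * κ) * ∫ s in Ioc 0 T, ρ s := by
  obtain ⟨hNc, hNX, hN⟩ := huN
  have hsub : ∀ {t}, t ∈ Icc 0 T → Ioc 0 t ⊆ Ioc 0 T := fun ht => Ioc_subset_Ioc_right ht.2
  have hVi : ∀ {t}, t ∈ Icc 0 T → IntervalIntegrable V volume 0 t := fun {t} ht => by
    rw [intervalIntegrable_iff_integrableOn_Ioc_of_le ht.1]
    exact IntegrableOn.mono_set (hV.integrable (by norm_num)) (hsub ht)
  have hNi : ∀ {t}, t ∈ Icc 0 T → IntervalIntegrable uN volume 0 t := fun {t} ht =>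
    (hNc.mono (by rw [uIcc_of_le ht.1]; exact Icc_subset_Icc_right ht.2)).intervalIntegrable
  set c : (Fin d → ℕ) → ℝ → ℝ :=
    fun n t => inner ℝ (hermiteBasis hα β n) ((uN t).toL2 - u t) with hc
  set g : (Fin d → ℕ) → ℝ → ℝ := fun n s => P.form (V s - uN s) (hermiteH1 hα β n) with hg
  have hgi : ∀ n, ∀ {t}, t ∈ Icc 0 T → IntervalIntegrable (g n) volume 0 t := fun n {t} ht =>
    intervalIntegrable_form_left hP ((hVi ht).sub (hNi ht)) _
  -- Error equation tested with one basis function: the `f` and `u₀` terms cancel, so each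
  -- coefficient of `E` is a primitive vanishing at `0`.
  have hcg : ∀ n ∈ F, ∀ {t}, t ∈ Icc 0 T → c n t = ∫ s in (0 : ℝ)..t, g n s := by
    intro n hn t ht
    have h1 := hsol (hermiteH1 hα β n) t ht
    have h2 := hN (hermiteH1 hα β n)
      (by rw [toL2_hermiteH1]; exact hermiteBasis_mem_approxSpace hα β (Finset.mem_coe.2 hn)) t ht
    have h3 : ∫ s in (0 : ℝ)..t, g n s = (∫ s in (0 : ℝ)..t, P.form (V s) (hermiteH1 hα β n))
        - ∫ s in (0 : ℝ)..t, P.form (uN s) (hermiteH1 hα β n) := by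
      rw [← intervalIntegral.integral_sub (intervalIntegrable_form_left hP (hVi ht) _)
        (intervalIntegrable_form_left hP (hNi ht) _)]
      refine intervalIntegral.integral_congr fun s _ => ?_
      simp only [hg]
      rw [← P.formCLM_apply hP, map_sub]
      rfl
    simp only [hc, inner_sub_right]
    rw [h3, real_inner_comm, real_inner_comm (u t), ← toL2_hermiteH1]
    linarith
  have hcgi : ∀ n ∈ F, IntervalIntegrable (fun s => c n s * g n s) volume 0 t := by
    intro n hn
    refine (hgi n ht).continuousOn_mul ?_
    refine (((hgi n ht).absolutelyContinuousOnInterval_intervalIntegral (c := 0)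
      (by simp)).continuousOn).congr fun s hs => ?_
    rw [uIcc_of_le ht.1] at hs
    exact hcg n hn ⟨hs.1, hs.2.trans ht.2⟩
  have henergy : ‖(hermiteProj hα β F ((uN t).toL2 - u t)).toL2‖ ^ 2
      = 2 * ∫ s in (0 : ℝ)..t, ∑ n ∈ F, c n s * g n s := by
    rw [norm_sq_toL2_hermiteProj, intervalIntegral.integral_finsetSum hcgi, Finset.mul_sum]
    refine Finset.sum_congr rfl fun n hn => ?_
    have h1 : c n t ^ 2 = 2 * ∫ s in (0 : ℝ)..t, (∫ r in (0 : ℝ)..s, g n r) * g n s := by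
      rw [hcg n hn ht, sq_intervalIntegral_eq (hgi n ht)]
    refine h1.trans ?_
    congr 1
    refine intervalIntegral.integral_congr fun s hs => ?_
    rw [uIcc_of_le ht.1] at hs
    rw [hcg n hn ⟨hs.1, hs.2.trans ht.2⟩]
  have hbound : ∫ s in (0 : ℝ)..t, ∑ n ∈ F, c n s * g n s
      ≤ ∫ s in (0 : ℝ)..t, C ^ 2 / (4 * κ) * ρ s := by
    have hρt : IntervalIntegrable ρ volume 0 t := by
      rw [intervalIntegrable_iff_integrableOn_Ioc_of_le ht.1]
      exact hρ.mono_set (hsub ht)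
    refine intervalIntegral.integral_mono_ae_restrict ht.1 ?_ (hρt.const_mul _) ?_
    · simpa only [Finset.sum_fn] using IntervalIntegrable.sum F hcgi
    · rw [Measure.restrict_congr_set Ioc_ae_eq_Icc.symm]
      have hmono := ae_mono (Measure.restrict_mono_set volume (hsub ht))
      filter_upwards [hmono hVu, hmono hVρ, ae_restrict_mem measurableSet_Ioc] with s h1 h2 hs
      have hsT : s ∈ Icc 0 T := ⟨hs.1.le, hs.2.trans ht.2⟩
      have h3 : ∑ n ∈ F, c n s * g n s
          = P.form (V s - uN s) (hermiteProj hα β F ((uN s).toL2 - u s)) := by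
        rw [← P.formCLM_apply hP, hermiteProj, map_sum]
        refine Finset.sum_congr rfl fun n _ => ?_
        rw [map_smul, smul_eq_mul]
        rfl
      -- The decomposition `R - E`; the projection fixes `uN s`, which already lies in the
      -- approximation space.
      have h4 : V s - uN s = (V s - hermiteProj hα β F (V s).toL2)
          - hermiteProj hα β F ((uN s).toL2 - u s) := by
        rw [hermiteProj_sub, hermiteProj_eq_self hα β (hNX s hsT), h1]
        abel
      rw [h3, h4]
      refine (Coefficients.form_sub_le hP hcoer hκ _ _).trans ?_
      gcongr
  have hlast : ∫ s in (0 : ℝ)..t, ρ s ≤ ∫ s in Ioc 0 T, ρ s := by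
    rw [intervalIntegral.integral_of_le ht.1]
    exact setIntegral_mono_set hρ (Filter.Eventually.of_forall hρ0)
      (Filter.Eventually.of_forall (hsub ht))
  have hnorm : ‖(hermiteProj hα β F (u t)).toL2 - (uN t).toL2‖
      = ‖(hermiteProj hα β F ((uN t).toL2 - u t)).toL2‖ := by
    rw [hermiteProj_sub, hermiteProj_eq_self hα β (hNX t ht), norm_sub_rev]
    rfl
  rw [hnorm, henergy]
  rw [intervalIntegral.integral_const_mul] at hbound
  calc 2 * ∫ s in (0 : ℝ)..t, ∑ n ∈ F, c n s * g n s
      ≤ 2 * (C ^ 2 / (4 * κ) * ∫ s in Ioc 0 T, ρ s) := by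
        gcongr
        exact hbound.trans (by gcongr)
    _ = _ := by
        field_simp
        ring

end Galerkin

end HermiteSpectral

end

/-! ### The error bound for the Galerkin Hermite method -/

open HermiteSpectral in
theorem theorem3p1 (d m : ℕ) (hd : 1 ≤ d) (hm : 1 < m) (α : Fin d → ℝ) (hα : ∀ j, 0 < α j)
    (γ : ℝ) (hγ : γ ≤ 1 / (m : ℝ)) (C κ : ℝ) (hC : 0 < C) (hκ : 0 < κ) :
    ∃ K : ℝ, 0 < K ∧
      ∀ (β : Fin d → ℝ) (P : Coefficients d),
        P.IsContinuous C → P.IsCoercive κ → P.IsSmooth →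
      ∀ (T : ℝ), 0 < T →
      ∀ (f : ℝ → L2 d), MeasureTheory.IntegrableOn f (Set.Ioc 0 T) →
      ∀ (u₀ : L2 d) (u : ℝ → L2 d), IsWeakSolution P T f u₀ u →
      ∀ (w : ℝ → Korobov α β m),
        (∀ᵐ s ∂(MeasureTheory.volume.restrict (Set.Ioc 0 T)), (w s).toL2 = u s) →
        MeasureTheory.MemLp w ⊤ (MeasureTheory.volume.restrict (Set.Ioc 0 T)) →
        MeasureTheory.MemLp w 2 (MeasureTheory.volume.restrict (Set.Ioc 0 T)) →
      ∀ (N : ℕ), 1 ≤ N →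
      ∀ (uN : ℝ → H1 d),
        IsGalerkinSolution P T f u₀ (approxSpace α β (hyperbolicCross d N γ)) uN →
      ∀ t ∈ Set.Icc 0 T,
        ‖u t - (uN t).toL2‖ ≤
          K * ((MeasureTheory.eLpNorm w ⊤ (MeasureTheory.volume.restrict (Set.Ioc 0 T))).toReal
              + (MeasureTheory.eLpNorm w 2 (MeasureTheory.volume.restrict (Set.Ioc 0 T))).toReal)
            * (N : ℝ) ^ ((1 - (m : ℝ)) / 2) := by
  have hγ1 : γ < 1 := by
    have h1 : (1 : ℝ) < m := by exact_mod_cast hm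
    exact hγ.trans_lt ((div_lt_one (by linarith)).2 h1)
  obtain ⟨K, hK, hproj⟩ := exists_norm_sub_hermiteProj_sq_le α hα hm hγ hγ1
  -- The first root comes from the projection error, the second from the energy estimate combined
  -- with it.
  refine ⟨Real.sqrt K + Real.sqrt (C ^ 2 / (2 * κ) * K), by positivity, ?_⟩
  intro β P hP hcoer _ T hT f _ u₀ u hu w hwu hwtop hw2 N hN uN huN t ht
  obtain ⟨huc, -, V, hV, hVu, hsol⟩ := hu
  set F := (finite_hyperbolicCross d N hγ1).toFinset
  have hF : (F : Set (Fin d → ℕ)) = hyperbolicCross d N γ := Set.Finite.coe_toFinset _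
  rw [← hF] at huN
  set r : ℝ := (N : ℝ) ^ ((1 - (m : ℝ)) / 2) with hr
  have hr0 : 0 ≤ r := by positivity
  have hr2 : (N : ℝ) ^ (1 - (m : ℝ)) = r ^ 2 := by
    rw [hr, ← Real.rpow_natCast, ← Real.rpow_mul (by positivity)]
    norm_num
  set A := (MeasureTheory.eLpNorm w ⊤ (MeasureTheory.volume.restrict (Set.Ioc 0 T))).toReal
  set B := (MeasureTheory.eLpNorm w 2 (MeasureTheory.volume.restrict (Set.Ioc 0 T))).toReal
  have hA : 0 ≤ A := ENNReal.toReal_nonneg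
  have hB : 0 ≤ B := ENNReal.toReal_nonneg
  have hVproj : ∀ᵐ s ∂(volume.restrict (Ioc 0 T)),
      ‖V s - hermiteProj hα β F (V s).toL2‖ ^ 2 ≤ K * r ^ 2 * ‖w s‖ ^ 2 := by
    filter_upwards [hVu, hwu] with s h1 h2
    rw [← hr2]
    exact hproj β (w s) (V s) (h1.trans h2.symm) N hN F hF
  have hwi : IntegrableOn (fun s => K * r ^ 2 * ‖w s‖ ^ 2) (Ioc 0 T) :=
    (hw2.integrable_norm_pow (by norm_num)).const_mul _
  have hgal := norm_sq_galerkin_sub_hermiteProj_le hα β hP hcoer hκ hV hVu hsol huN hwi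
    (fun s => by positivity) hVproj ht
  rw [integral_const_mul, integral_norm_sq_eq_eLpNorm hw2] at hgal
  have h1 : ‖(hermiteProj hα β F (u t)).toL2 - (uN t).toL2‖
      ≤ Real.sqrt (C ^ 2 / (2 * κ) * K) * (r * B) := by
    refine abs_le_of_sq_le_sq' ?_ (by positivity) |>.2
    rw [mul_pow, Real.sq_sqrt (by positivity)]
    exact hgal.trans (le_of_eq (by ring))
  have h2 : ‖u t - (hermiteProj hα β F (u t)).toL2‖ ≤ Real.sqrt K * (r * A) := by
    -- The Korobov bound holds only for almost every time; continuity of `u` in `L²` extends it to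
    -- every `t`.
    refine le_of_ae_le_of_continuousOn (h := fun t => ‖u t - (hermiteProj hα β F (u t)).toL2‖)
      hT ?_ ?_ t ht
    · simp only [toL2_hermiteProj]
      refine (huc.sub (continuousOn_finsetSum _ fun n _ => ?_)).norm
      exact ((innerSL ℝ (hermiteBasis hα β n)).continuous.comp_continuousOn huc).smul
        continuousOn_const
    · filter_upwards [hVu, hVproj, ae_norm_le_eLpNorm_top hwtop] with s h1 h2 h3
      have h4 : u s - (hermiteProj hα β F (u s)).toL2
          = (V s - hermiteProj hα β F (V s).toL2).toL2 := by
        rw [h1, ← h1]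
        rfl
      rw [h4]
      refine (norm_toL2_le _).trans (abs_le_of_sq_le_sq' ?_ (by positivity) |>.2)
      refine h2.trans ?_
      rw [mul_pow, Real.sq_sqrt hK.le, mul_pow, ← mul_assoc]
      gcongr
  calc ‖u t - (uN t).toL2‖
      ≤ ‖u t - (hermiteProj hα β F (u t)).toL2‖
        + ‖(hermiteProj hα β F (u t)).toL2 - (uN t).toL2‖ := norm_sub_le_norm_sub_add_norm_sub _ _ _
    _ ≤ Real.sqrt K * (r * A) + Real.sqrt (C ^ 2 / (2 * κ) * K) * (r * B) := add_le_add h2 h1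
    -- The nonnegative cross terms complete the product of the two sums.
    _ ≤ Real.sqrt K * (r * A) + Real.sqrt (C ^ 2 / (2 * κ) * K) * (r * B)
        + (Real.sqrt K * (r * B) + Real.sqrt (C ^ 2 / (2 * κ) * K) * (r * A)) :=
        le_add_of_nonneg_right (by positivity)
    _ = _ := by ring
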